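/- \textbf{Setting.} Let $P,\sigma>0$, $v=P/\sigma^2$, $\alpha_0\in(0,1]$, and let $d,n,L,M\ge 1$ be integers. Put $N=LM$ and let $\mathcal B\subset\{0,1\}^N$ be the set of vectors that have exactly one entry $1$ in each of the $L$ consecutive sections of size $M$. The binomial dictionary is the random matrix $X\in\mathbb R^{n\times N}$ with entries $X_{ij}=\sum_{k=d(j-1)+1}^{dj}\tilde X_{ik}$, where the $n\times dN$ entries of $\tilde X$ are independent and each equals $\pm\sqrt{P/(dL)}$ with probability $1/2$. For $\beta\in\mathcal B$ let $Y=X\beta+\epsilon$, where $\epsilon$ has $n$ independent $N(0,\sigma^2)$ coordinates and is independent of $X$. Let $\hat\beta$ be a maximum likelihood decoder, that is, a function of $(X,Y)$ with $\hat\beta\in\arg\min_{\beta'\in\mathcal B}\|Y-X\beta'\|^2$ (ties are broken in an arbitrary way). Let $E_l$ be the event that $\hat\beta$ and $\beta$ differ in exactly $l$ sections. Let $R=(L\ln M)/n$ be the rate in nats per transmission. Define $$C_\alpha=\tfrac12\ln(1+\alpha v),\qquad D_1(\Delta,q)=\max_{0\le\lambda\le1}\Bigl\{\lambda\Delta+\tfrac12\ln(1-\lambda^2q)\Bigr\}\quad(q<1),\qquad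 \eta=\sqrt{9/(8\pi e)},$$ $$\phi(k)=\inf_{\zeta\in(0,1/2)}\max\Bigl\{\Bigl(\tfrac3{16}c_\zeta^2+\tfrac1{12}\Bigr)\tfrac1k,\ -\tfrac{4\zeta^4}{3}k+\ln\tfrac k2+\tfrac1{12k},\ -\bigl(\ln2-\tfrac12\bigr)k+\tfrac12\ln\tfrac{\pi k}{2}\Bigr\},\quad c_\zeta=\tfrac1{(1+2\zeta)^2}+\tfrac1{(1-2\zeta)^2},$$ $$\iota'=\max_{\alpha_0L\le l\le L}\Bigl\{2\phi(dl)+\ln\Bigl(\Bigl(1+\tfrac{\eta(1+v)}{dl}\Bigr)\Bigl(1+\tfrac{2\eta}{dl}\Bigr)\Bigr)\Bigr\},$$ where the last maximum is over integers $l$. \textbf{Lemma.} For every such $P,\sigma,\alpha_0$, the following holds. (1) For all $d,n,L,M\ge1$, every maximum likelihood decoder, every transmitted $\beta\in\mathcal B$, and every integer $l\le L$ such that $\alpha=l/L$ satisfies $\alpha_0\le\alpha\le1$, $$\mathbb P_\beta[E_l]\le\binom{L}{\alpha L}\exp\Bigl\{-n\Bigl(D_1\Bigl(C_\alpha-\alpha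 R,\ \frac{\alpha v}{1+\alpha v}\Bigr)-\iota'\Bigr)\Bigr\}.$$ (2) $\iota'=O(1/L)$: there is a constant $K$, depending only on $P,\sigma,\alpha_0$, such that $|\iota'|\le K/L$ for all $d,L\ge1$. -/

import Mathlib

open MeasureTheory ProbabilityTheory Matrix

noncomputable section

namespace SSCode

/-! ### The code

The columns of the dictionary are indexed by `Fin L × Fin M`: the pair `(s, m)` is the `m`-th
column of section `s`. -/

/-- The set of admissible coefficient vectors: vectors with entries in `{0, 1}`, having exactly one
entry equal to `1` in each of the `L` sections of size `M`. -/
def coeffSet (L M : ℕ) : Set (Fin L × Fin M → ℝ) :=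
  {β | (∀ j, β j = 0 ∨ β j = 1) ∧ ∀ s, ∃! m, β (s, m) = 1}

/-- The transmission rate `R = K / n`, where `2 ^ K = M ^ L`, measured in nats per transmission:
`R = (L ln M) / n`. -/
def rate (n L M : ℕ) : ℝ := L * Real.log M / n

/-- The number of sections in which two coefficient vectors differ. -/
def mistakes {L M : ℕ} (β' β : Fin L × Fin M → ℝ) : ℕ :=
  {s : Fin L | ∃ m, β' (s, m) ≠ β (s, m)}.ncard

/-- A decoder (a function of the dictionary and of the channel output) is a maximum likelihood
decoder if it always returns a minimizer of `‖Y - X β‖²` over the admissible vectors. Ties may be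
broken in any way. -/
def IsMLDecoder {n L M : ℕ}
    (dec : Matrix (Fin n) (Fin L × Fin M) ℝ → (Fin n → ℝ) → (Fin L × Fin M → ℝ)) : Prop :=
  ∀ X Y, dec X Y ∈ coeffSet L M ∧
    ∀ β ∈ coeffSet L M,
      ‖WithLp.toLp 2 (Y - X *ᵥ dec X Y)‖ ^ 2 ≤ ‖WithLp.toLp 2 (Y - X *ᵥ β)‖ ^ 2

/-! ### The random dictionary and the noise -/

/-- The equiprobable law on the two points `a` and `-a`. -/
def signLaw (a : ℝ) : Measure ℝ :=
  (2⁻¹ : ENNReal) • Measure.dirac a + (2⁻¹ : ENNReal) • Measure.dirac (-a)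

/-- The law of the `n × dN` matrix (`N = L M`) with independent entries, each of them equal to
`√(P / (d L))` or `-√(P / (d L))` with probability `1/2`. The `d` columns used for the
dictionary column `j` are indexed by `(j, k)`, `k : Fin d`. -/
def signMatrixLaw (P : ℝ) (d n L M : ℕ) :
    Measure (Fin n → (Fin L × Fin M) × Fin d → ℝ) :=
  Measure.pi fun _ => Measure.pi fun _ => signLaw (√(P / (d * L)))

/-- The binomial dictionary: each entry is the sum of `d` entries of the sign matrix. -/
def dictionary {d n L M : ℕ} (Z : Fin n → (Fin L × Fin M) × Fin d → ℝ) :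
    Matrix (Fin n) (Fin L × Fin M) ℝ :=
  Matrix.of fun i j => ∑ k, Z i (j, k)

/-- The law of the noise: `n` independent `N(0, σ²)` variables. -/
def noiseLaw (σ : ℝ) (n : ℕ) : Measure (Fin n → ℝ) :=
  Measure.pi fun _ => gaussianReal 0 (σ ^ 2).toNNReal

/-- The joint law of the sign matrix (which determines the dictionary) and of the noise; they are
independent. -/
def jointLaw (P σ : ℝ) (d n L M : ℕ) :
    Measure ((Fin n → (Fin L × Fin M) × Fin d → ℝ) × (Fin n → ℝ)) :=
  (signMatrixLaw P d n L M).prod (noiseLaw σ n)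

/-- The event `mistakes = l` when `β` is sent, the channel output is `Y = X β + ε` and the receiver
uses the decoder `dec`. -/
def mistakesEvent {d n L M : ℕ}
    (dec : Matrix (Fin n) (Fin L × Fin M) ℝ → (Fin n → ℝ) → (Fin L × Fin M → ℝ))
    (β : Fin L × Fin M → ℝ) (l : ℕ) :
    Set ((Fin n → (Fin L × Fin M) × Fin d → ℝ) × (Fin n → ℝ)) :=
  {ω | mistakes (dec (dictionary ω.1) (dictionary ω.1 *ᵥ β + ω.2)) β = l}

/-! ### The error bound -/

/-- `C_α = (1/2) ln (1 + α v)`. -/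
def capacity (v α : ℝ) : ℝ := 1 / 2 * Real.log (1 + α * v)

/-- `D₁(Δ, q)`, the maximum over `0 ≤ t ≤ 1` of `t Δ + (1/2) ln (1 - t² q)`, for `q < 1`. -/
def D₁ (Δ q : ℝ) : ℝ :=
  sSup ((fun t : ℝ => t * Δ + 1 / 2 * Real.log (1 - t ^ 2 * q)) '' Set.Icc 0 1)

/-- The supremum in `D₁` is a maximum. -/
theorem D₁_isGreatest (Δ q : ℝ) (hq : q < 1) :
    IsGreatest ((fun t : ℝ => t * Δ + 1 / 2 * Real.log (1 - t ^ 2 * q)) '' Set.Icc 0 1)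
      (D₁ Δ q) := by
  refine IsCompact.isGreatest_sSup (isCompact_Icc.image_of_continuousOn ?_) ⟨_, 0, by simp, rfl⟩
  refine ContinuousOn.add (by fun_prop) (continuousOn_const.mul (ContinuousOn.log (by fun_prop) ?_))
  rintro t ⟨h0, h1⟩
  have : t ^ 2 ≤ 1 := by nlinarith
  have : 0 ≤ t ^ 2 := sq_nonneg t
  rcases le_total q 0 with h | h <;> nlinarith

/-- `c_ζ = 1 / (1 + 2 ζ)² + 1 / (1 - 2 ζ)²`. -/
def cZeta (ζ : ℝ) : ℝ := 1 / (1 + 2 * ζ) ^ 2 + 1 / (1 - 2 * ζ) ^ 2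

/-- The function `φ_ζ`. -/
def phiZeta (ζ : ℝ) (k : ℕ) : ℝ :=
  max (max ((3 / 16 * cZeta ζ ^ 2 + 1 / 12) * (1 / k))
      (-(4 * ζ ^ 4 / 3) * k + Real.log (k / 2) + 1 / (12 * k)))
    (-(Real.log 2 - 1 / 2) * k + 1 / 2 * Real.log (Real.pi * k / 2))

/-- `φ(k)`, the infimum of `φ_ζ(k)` over `0 < ζ < 1/2`. -/
def phi (k : ℕ) : ℝ := sInf ((fun ζ => phiZeta ζ k) '' Set.Ioo 0 (1 / 2))

/-- `η = √(9 / (8 π e))`. -/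
def eta : ℝ := √(9 / (8 * Real.pi * Real.exp 1))

/-- `2 φ(dl) + ln ((1 + η (1 + v) / (dl)) (1 + 2 η / (dl)))`. -/
def iotaTerm (v : ℝ) (d l : ℕ) : ℝ :=
  2 * phi (d * l) +
    Real.log ((1 + eta * (1 + v) / (d * l : ℕ)) * (1 + 2 * eta / (d * l : ℕ)))

/-- `ι'`, the maximum of `iotaTerm v d l` over the integers `l` with `α₀ L ≤ l ≤ L`. -/
def iota' (v α₀ : ℝ) (d L : ℕ) : ℝ :=
  sSup ((fun l : ℕ => iotaTerm v d l) '' {l : ℕ | α₀ * L ≤ l ∧ l ≤ L})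

/-- The supremum in `iota'` is a maximum. -/
theorem iota'_isGreatest (v α₀ : ℝ) (hα₀ : α₀ ≤ 1) (d L : ℕ) :
    IsGreatest ((fun l : ℕ => iotaTerm v d l) '' {l : ℕ | α₀ * L ≤ l ∧ l ≤ L})
      (iota' v α₀ d L) := by
  have hf : {l : ℕ | α₀ * L ≤ l ∧ l ≤ L}.Finite :=
    (Set.finite_Iic L).subset fun l hl => hl.2
  have hL : L ∈ {l : ℕ | α₀ * L ≤ l ∧ l ≤ L} :=
    ⟨mul_le_of_le_one_left (Nat.cast_nonneg L) hα₀, le_rfl⟩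
  exact (hf.image _).isCompact.isGreatest_sSup ⟨_, L, hL, rfl⟩

/-- The bound on the probability of `l` section mistakes, with `α = l / L`. -/
def errBin' (v α₀ : ℝ) (d n L M l : ℕ) : ℝ :=
  let α : ℝ := l / L
  L.choose l * Real.exp (-(n * (D₁ (capacity v α - α * rate n L M) (α * v / (1 + α * v))
    - iota' v α₀ d L)))

end SSCode

end

noncomputable section

namespace SSCode

/-! ### Local bound for the symmetric binomial distribution -/

/-! Fix a set `S` of `l` wrong sections. In each row let `u` and `w` be the contributions in `S` of
the sent columns and of a competitor's columns. They are independent sums of `k = dl` signs, each of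
variance `V = αP`. With `s = σ²`, the tilt `G` and the weights `F` are chosen so that `G F^t` is at
least 1 whenever the competitor beats the sent word. Gallager's argument (`measure_le_of_tilt`) then
gives `(M^l c^n)^t (E G)^n`, with `E G` taken per row and `c` a bound, uniform in the output, on the
mean of `F` over one row.

If `u`, `w` were Gaussian, both moments would be exact: `c = (1 + αv)^(-1/2) = exp(-C_α)` and `E G =
(1 - t²q)^(-1/2)` with `q = αv/(1 + αv)`. The maximizing `t` in `D₁` gives the exponent, and the
union over `S` gives the binomial coefficient.

Signs replace Gaussians at a controlled cost. By Stirling the binomial mass is at most `exp (phi k)`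
times a lattice Gaussian weight (`choose_div_two_pow_le`). Both integrands are exponentials of
quadratics, so the weighted sum is again Gaussian, of relative precision `τ`, and Poisson summation
bounds it by the integral times `1 + ητ/k` (`sum_gaussian_le`). Here `τ ≤ 1 + v` for `F` and `τ ≤ 2`
for `G`, whence the two factors in `iotaTerm`. Finally `phi k = O(1/k)` and `k ≥ α₀L` give part (2).
-/

theorem log_stirlingSeq_le {n : ℕ} (hn : n ≠ 0) :
    Real.log (Stirling.stirlingSeq n) ≤ Real.log √Real.pi + 1 / (12 * n) := by
  -- One step lowers `log stirlingSeq` by at most `1/(12m(m+1))`, which telescopes; after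
  -- subtracting `1/(12m)` the sequence increases to its limit `log √π`.
  have hmono : Monotone fun m : ℕ =>
      Real.log (Stirling.stirlingSeq (m + 1)) - 1 / (12 * ((m + 1 : ℕ) : ℝ)) := by
    refine monotone_nat_of_le_succ fun m => ?_
    have h := Stirling.log_stirlingSeq_sdiff_le (m + 1)
    have e : (1 : ℝ) / (12 * ((m + 1 : ℕ) : ℝ) * (((m + 1 : ℕ) : ℝ) + 1)) =
        1 / (12 * ((m + 1 : ℕ) : ℝ)) - 1 / (12 * ((m + 1 + 1 : ℕ) : ℝ)) := by
      push_cast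
      field_simp
      ring
    rw [e] at h
    linarith
  have hpi : √Real.pi ≠ 0 := by positivity
  have hlim : Filter.Tendsto (fun m : ℕ =>
      Real.log (Stirling.stirlingSeq (m + 1)) - 1 / (12 * ((m + 1 : ℕ) : ℝ)))
      Filter.atTop (nhds (Real.log √Real.pi - 0)) := by
    refine Filter.Tendsto.sub ?_ ?_
    · exact ((Stirling.tendsto_stirlingSeq_sqrt_pi.comp (Filter.tendsto_add_atTop_nat 1)).log hpi)
    · have := (tendsto_one_div_atTop_nhds_zero_nat (𝕜 := ℝ)).const_mul (1 / 12)
      have := this.comp (Filter.tendsto_add_atTop_nat 1)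
      simp only [mul_zero] at this
      refine this.congr fun m => ?_
      simp only [Function.comp]
      field_simp
  obtain ⟨m, rfl⟩ := Nat.exists_eq_succ_of_ne_zero hn
  have := hmono.ge_of_tendsto hlim m
  simp only [Nat.succ_eq_add_one] at *
  linarith

theorem log_factorial_le {n : ℕ} (hn : n ≠ 0) :
    Real.log n.factorial ≤ n * Real.log n - n + Real.log n / 2 + Real.log (2 * Real.pi) / 2
      + 1 / (12 * n) := by
  have h := log_stirlingSeq_le hn
  have hn' : (n : ℝ) ≠ 0 := by exact_mod_cast hn
  rw [Stirling.log_stirlingSeq_formula, Real.log_sqrt Real.pi_pos.le,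
    Real.log_mul two_ne_zero hn', Real.log_div hn' (Real.exp_ne_zero _), Real.log_exp] at h
  rw [Real.log_mul two_ne_zero Real.pi_ne_zero]
  linarith

/-- The right side is the power series `∑ y^(2k+2) / ((2k+1)(k+1))` with nonnegative terms; the
first two are kept. -/
theorem sq_add_le_entropy {y : ℝ} (hy : |y| < 1) :
    y ^ 2 + y ^ 4 / 6 ≤ (1 + y) * Real.log (1 + y) + (1 - y) * Real.log (1 - y) := by
  have hy2 : |y ^ 2| < 1 := by
    rw [abs_pow]
    exact pow_lt_one₀ (abs_nonneg _) hy two_ne_zero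
  obtain ⟨h1, h2⟩ := abs_lt.1 hy
  have s1 := (Real.hasSum_log_sub_log_of_abs_lt_one hy).mul_left y
  have s2 := Real.hasSum_pow_div_log_of_abs_lt_one hy2
  have s := s1.sub s2
  have e : y * (Real.log (1 + y) - Real.log (1 - y)) - -Real.log (1 - y ^ 2) =
      (1 + y) * Real.log (1 + y) + (1 - y) * Real.log (1 - y) := by
    rw [show 1 - y ^ 2 = (1 + y) * (1 - y) by ring,
      Real.log_mul (by linarith) (by linarith)]
    ring
  rw [e] at s
  have := sum_le_hasSum (Finset.range 2) (fun k _ => ?_) s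
  · simp only [Finset.sum_range_succ, Finset.range_zero, Finset.sum_empty] at this
    refine le_trans (le_of_eq ?_) this
    push_cast
    ring
  · have e' : y * (2 * (1 / (2 * (k : ℝ) + 1)) * y ^ (2 * k + 1)) -
        (y ^ 2) ^ (k + 1) / ((k : ℝ) + 1) =
        (y ^ 2) ^ (k + 1) * (1 / ((2 * (k : ℝ) + 1) * (k + 1))) := by
      rw [← pow_mul]
      field_simp
      ring
    rw [e']
    positivity

/-- Stirling bound for a binomial coefficient in terms of the normalised deviation. -/
theorem log_choose_le {k j : ℕ} (hj : 0 < j) (hjk : j < k) {y : ℝ}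
    (hy : y = (2 * j - k) / k) :
    Real.log (k.choose j) - k * Real.log 2 ≤
      -(k * y ^ 2 / 2) - k * y ^ 4 / 12 - Real.log (1 - y ^ 2) / 2
        + Real.log (2 / (Real.pi * k)) / 2 + 1 / (12 * k) := by
  have hk : (0 : ℝ) < k := by exact_mod_cast hj.trans hjk
  have hj' : (0 : ℝ) < j := by exact_mod_cast hj
  have hjk' : (j : ℝ) < k := by exact_mod_cast hjk
  have hkn : k ≠ 0 := by omega
  obtain ⟨m, rfl⟩ := Nat.exists_eq_add_of_lt hjk
  set m' := m + 1 with hm'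
  have hm0 : (0 : ℝ) < m' := by positivity
  have hkm : ((j + m + 1 : ℕ) : ℝ) = j + m' := by rw [hm']; push_cast; ring
  set K : ℝ := ((j + m + 1 : ℕ) : ℝ) with hK
  have hjy : (j : ℝ) = K * (1 + y) / 2 := by rw [hy]; field_simp; ring
  have hmy : (m' : ℝ) = K * (1 - y) / 2 := by
    have : (m' : ℝ) = K - j := by linarith
    rw [this, hjy]; ring
  have hy1 : 0 < 1 + y := by
    by_contra h
    nlinarith
  have hy2 : 0 < 1 - y := by
    by_contra h
    nlinarith
  have hc : Real.log ((j + m + 1).choose j) =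
      Real.log (j + m + 1).factorial - Real.log j.factorial - Real.log m'.factorial := by
    have h := Nat.choose_mul_factorial_mul_factorial (Nat.le_add_right j m')
    rw [Nat.add_sub_cancel_left] at h
    have h' : (((j + m').choose j : ℝ)) * j.factorial * m'.factorial = (j + m').factorial := by
      exact_mod_cast h
    have hp : (0 : ℝ) < ((j + m').choose j : ℕ) := by
      exact_mod_cast Nat.choose_pos (Nat.le_add_right _ _)
    have : (j + m + 1) = j + m' := by omega
    rw [this, ← h', Real.log_mul (by positivity) (by positivity),
      Real.log_mul (by positivity) (by positivity)]
    ring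
  -- Only the numerator needs the upper Stirling bound; the denominators use the lower bound without
  -- correction, so the sole error is `1/(12k)`.
  have f1 := log_factorial_le hkn
  have f2 := Stirling.le_log_factorial_stirling (n := j) (by omega)
  have f3 := Stirling.le_log_factorial_stirling (n := m') (by omega)
  have l1 : Real.log j = Real.log K + Real.log (1 + y) - Real.log 2 := by
    rw [hjy, Real.log_div (by positivity) two_ne_zero, Real.log_mul hk.ne' hy1.ne']
  have l2 : Real.log m' = Real.log K + Real.log (1 - y) - Real.log 2 := by
    rw [hmy, Real.log_div (by positivity) two_ne_zero, Real.log_mul hk.ne' hy2.ne']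
  have l3 : Real.log (1 - y ^ 2) = Real.log (1 + y) + Real.log (1 - y) := by
    rw [← Real.log_mul hy1.ne' hy2.ne']; congr 1; ring
  have l4 : Real.log (2 / (Real.pi * K)) = Real.log 2 - Real.log Real.pi - Real.log K := by
    rw [Real.log_div two_ne_zero (by positivity), Real.log_mul Real.pi_ne_zero hk.ne']; ring
  have l5 : Real.log (2 * Real.pi) = Real.log 2 + Real.log Real.pi :=
    Real.log_mul two_ne_zero Real.pi_ne_zero
  have ent := mul_le_mul_of_nonneg_left
    (sq_add_le_entropy (abs_lt.2 ⟨by linarith, by linarith⟩ : |y| < 1)) hk.le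
  rw [l1] at f2
  rw [l2] at f3
  rw [hjy] at f2
  rw [hmy] at f3
  rw [hc, l3, l4]
  rw [l5] at f1 f2 f3
  nlinarith [f1, f2, f3, ent]

/-- Follows from `-log(1 - y²) ≤ y²/(1 - y²)` and `1/(1 - z²) ≤ (1 + z²)/(1 - z²)² = cZeta (z/2) /
2`. -/
theorem neg_log_one_sub_sq_le {y z : ℝ} (hz : z < 1) (hy : |y| ≤ z) :
    -(Real.log (1 - y ^ 2) / 2) ≤ cZeta (z / 2) / 4 * y ^ 2 := by
  have hz0 : 0 ≤ z := (abs_nonneg y).trans hy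
  have hs : y ^ 2 ≤ z ^ 2 := sq_le_sq' (abs_le.1 hy).1 (abs_le.1 hy).2
  have hz2 : z ^ 2 < 1 := by nlinarith
  have hp : 0 < 1 - y ^ 2 := by linarith
  have h1 : -Real.log (1 - y ^ 2) ≤ 1 / (1 - y ^ 2) - 1 := by
    have := Real.log_le_sub_one_of_pos (inv_pos.2 hp)
    rw [Real.log_inv] at this
    simpa using this
  have h2 : 1 / (1 - y ^ 2) - 1 = 1 / (1 - y ^ 2) * y ^ 2 := by
    field_simp; ring
  have h3 : 1 / (1 - y ^ 2) ≤ 1 / (1 - z ^ 2) :=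
    one_div_le_one_div_of_le (by linarith) (by linarith)
  have h4 : 1 / (1 - z ^ 2) ≤ cZeta (z / 2) / 2 := by
    have a : 1 + 2 * (z / 2) = 1 + z := by ring
    have b : 1 - 2 * (z / 2) = 1 - z := by ring
    have e : cZeta (z / 2) / 2 = (1 + z ^ 2) / (1 - z ^ 2) ^ 2 := by
      have : 1 - z ≠ 0 := by linarith
      have : 1 + z ≠ 0 := by linarith
      rw [cZeta, a, b, show 1 - z ^ 2 = (1 - z) * (1 + z) by ring]
      field_simp
      ring
    rw [e, div_le_div_iff₀ (by linarith) (by nlinarith)]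
    nlinarith
  have := mul_le_mul_of_nonneg_right (h3.trans h4) (sq_nonneg y)
  linarith

/-- The three branches of the maximum serve the centre `|y| ≤ 2ζ`, the tails with `0 < j < k`, and
the endpoints `j = 0, k`, where Stirling is not used. -/
theorem log_choose_le_phiZeta {ζ : ℝ} (hζ : ζ ∈ Set.Ioo (0 : ℝ) (1 / 2)) {k j : ℕ} (hk : 0 < k)
    (hj : j ≤ k) :
    Real.log (k.choose j) - k * Real.log 2 ≤
      phiZeta ζ k + Real.log (2 / (Real.pi * k)) / 2 - (2 * j - k) ^ 2 / (2 * k) := by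
  have hk' : (0 : ℝ) < k := by exact_mod_cast hk
  have hlog : Real.log (2 / (Real.pi * k)) = -Real.log (Real.pi * k / 2) := by
    rw [← Real.log_inv, inv_div]
  have hend : ∀ c : ℝ, c = k ^ 2 →
      0 - k * Real.log 2 ≤ phiZeta ζ k + Real.log (2 / (Real.pi * k)) / 2 - c / (2 * k) := by
    intro c hc
    have : -(Real.log 2 - 1 / 2) * k + 1 / 2 * Real.log (Real.pi * k / 2) ≤ phiZeta ζ k :=
      le_max_right _ _
    have e : c / (2 * k) = k / 2 := by rw [hc]; field_simp
    rw [e, hlog]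
    linarith
  rcases Nat.eq_zero_or_pos j with rfl | hj0
  · simpa using hend _ (by ring)
  rcases hj.eq_or_lt with rfl | hjk
  · simpa using hend _ (by ring)
  set y : ℝ := (2 * j - k) / k with hy
  have main := log_choose_le hj0 hjk hy
  have ey : (2 * (j : ℝ) - k) ^ 2 / (2 * k) = k * y ^ 2 / 2 := by rw [hy]; field_simp
  rw [ey]
  by_cases hyz : |y| ≤ 2 * ζ
  · have h1 := neg_log_one_sub_sq_le (by linarith [hζ.2]) hyz
    have h2 : (3 / 16 * cZeta ζ ^ 2 + 1 / 12) * (1 / k) ≤ phiZeta ζ k :=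
      (le_max_left _ _).trans (le_max_left _ _)
    rw [show 2 * ζ / 2 = ζ by ring] at h1
    -- A concave quadratic in `y²`, maximal at `y² = 3c/(2k)`: the quartic entropy term absorbs the
    -- logarithm.
    have h3 : cZeta ζ / 4 * y ^ 2 - k * y ^ 4 / 12 ≤ 3 / 16 * cZeta ζ ^ 2 * (1 / k) := by
      have : 3 / 16 * cZeta ζ ^ 2 * (1 / k) - (cZeta ζ / 4 * y ^ 2 - k * y ^ 4 / 12) =
          (k * y ^ 2 - 3 / 2 * cZeta ζ) ^ 2 / (12 * k) := by
        field_simp; ring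
      have : 0 ≤ (k * y ^ 2 - 3 / 2 * cZeta ζ) ^ 2 / (12 * k) := by positivity
      linarith
    have h4 : (1 : ℝ) / (12 * k) = 1 / 12 * (1 / k) := by field_simp
    rw [add_mul] at h2
    linarith
  · push Not at hyz
    have h2 : -(4 * ζ ^ 4 / 3) * k + Real.log (k / 2) + 1 / (12 * k) ≤ phiZeta ζ k :=
      (le_max_right _ _).trans (le_max_left _ _)
    have h3 : (2 * ζ) ^ 4 ≤ y ^ 4 := by
      rw [← (show Even 4 by decide).pow_abs y]
      exact pow_le_pow_left₀ (by linarith [hζ.1]) hyz.le 4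
    -- Here `1 - y² = 4j(k-j)/k²`, and `j(k-j) ≥ 1` away from the endpoints.
    have h4 : -(Real.log (1 - y ^ 2) / 2) ≤ Real.log (k / 2) := by
      have e : 1 - y ^ 2 = (2 / k : ℝ) ^ 2 * (j * (k - j)) := by rw [hy]; field_simp; ring
      have hj1 : (1 : ℝ) ≤ j := by exact_mod_cast hj0
      have hj2 : (j : ℝ) + 1 ≤ k := by exact_mod_cast hjk
      have h5 : (2 / k : ℝ) ^ 2 ≤ 1 - y ^ 2 := by
        rw [e]
        exact le_mul_of_one_le_right (by positivity) (by nlinarith)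
      have h6 := Real.log_le_log (by positivity) h5
      rw [Real.log_pow] at h6
      have h7 : Real.log (k / 2) = -Real.log (2 / k) := by rw [← Real.log_inv, inv_div]
      push_cast at h6
      linarith
    nlinarith

theorem phiZeta_nonneg (ζ : ℝ) (k : ℕ) : 0 ≤ phiZeta ζ k :=
  le_trans (by positivity) ((le_max_left _ _).trans (le_max_left _ _))

theorem phi_nonneg (k : ℕ) : 0 ≤ phi k :=
  Real.sInf_nonneg (by rintro _ ⟨ζ, -, rfl⟩; exact phiZeta_nonneg ζ k)

/-- The symmetric binomial law is at most `exp (phi k)` times the matching Gaussian weight. -/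
theorem choose_div_two_pow_le {k j : ℕ} (hk : 0 < k) (hj : j ≤ k) :
    (k.choose j : ℝ) * (1 / 2) ^ k ≤
      Real.exp (phi k) * (√(2 / (Real.pi * k)) * Real.exp (-((2 * j - k) ^ 2 / (2 * k)))) := by
  have hk' : (0 : ℝ) < k := by exact_mod_cast hk
  have hc : (0 : ℝ) < k.choose j := by exact_mod_cast Nat.choose_pos hj
  have key : Real.log (k.choose j) - k * Real.log 2
      - Real.log (2 / (Real.pi * k)) / 2 + (2 * j - k) ^ 2 / (2 * k) ≤ phi k := by
    refine le_csInf ⟨_, 1 / 4, by norm_num, rfl⟩ ?_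
    rintro _ ⟨ζ, hζ, rfl⟩
    have := log_choose_le_phiZeta hζ hk hj
    simp only
    linarith
  rw [← Real.exp_log (show 0 < √(2 / (Real.pi * k)) by positivity),
    Real.log_sqrt (by positivity), ← Real.exp_add, ← Real.exp_add,
    ← Real.log_le_iff_le_exp (by positivity), Real.log_mul (by positivity) (by positivity),
    Real.log_pow, one_div, Real.log_inv]
  linarith

/-! ### Gaussian sums over a lattice -/

theorem exp_neg_le_one_div {x : ℝ} (hx : 0 < x) : Real.exp (-x) ≤ 1 / (Real.exp 1 * x) := by
  have h : Real.exp 1 * x ≤ Real.exp x := by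
    have := mul_le_mul_of_nonneg_left (Real.add_one_le_exp (x - 1)) (Real.exp_pos 1).le
    rw [← Real.exp_add] at this
    simpa using this
  rw [Real.exp_neg, ← one_div]
  exact one_div_le_one_div_of_le (by positivity) h

/-- The term `n = 0` is `1 / 0 = 0`, so this is `2ζ(2)`. -/
theorem hasSum_int_one_div_sq : HasSum (fun n : ℤ => 1 / (n : ℝ) ^ 2) (Real.pi ^ 2 / 3) := by
  have h := HasSum.of_nat_of_neg (f := fun n : ℤ => 1 / (n : ℝ) ^ 2) (by simpa using hasSum_zeta_two)
    (by simpa using hasSum_zeta_two)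
  convert! h using 1
  simp
  ring

theorem summable_and_tsum_exp_neg_mul_int_sq_le {b : ℝ} (hb : 0 < b) :
    (Summable fun n : ℤ => Real.exp (-(b * (n : ℝ) ^ 2))) ∧
      ∑' n : ℤ, Real.exp (-(b * (n : ℝ) ^ 2)) ≤ 1 + Real.pi ^ 2 / (3 * (Real.exp 1 * b)) := by
  have hg : HasSum (fun n : ℤ => (if n = 0 then (1 : ℝ) else 0) +
      1 / (Real.exp 1 * b) * (1 / (n : ℝ) ^ 2))
      (1 + 1 / (Real.exp 1 * b) * (Real.pi ^ 2 / 3)) :=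
    (hasSum_ite_eq 0 1).add (hasSum_int_one_div_sq.mul_left _)
  have hle : ∀ n : ℤ, Real.exp (-(b * (n : ℝ) ^ 2)) ≤ (if n = 0 then (1 : ℝ) else 0) +
      1 / (Real.exp 1 * b) * (1 / (n : ℝ) ^ 2) := by
    intro n
    by_cases hn : n = 0
    · simp [hn]
    · have hn' : (n : ℝ) ≠ 0 := by exact_mod_cast hn
      rw [if_neg hn, zero_add]
      refine (exp_neg_le_one_div (by positivity)).trans (le_of_eq ?_)
      field_simp
  have hs : Summable fun n : ℤ => Real.exp (-(b * (n : ℝ) ^ 2)) :=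
    Summable.of_nonneg_of_le (fun n => (Real.exp_pos _).le) hle hg.summable
  refine ⟨hs, (hasSum_le hle hs.hasSum hg).trans (le_of_eq ?_)⟩
  field_simp

theorem summable_exp_neg_mul_int_sub_sq {b : ℝ} (hb : 0 < b) (c : ℝ) :
    Summable fun n : ℤ => Real.exp (-(b * ((n : ℝ) - c) ^ 2)) := by
  -- Half the precision pays for the shift: `(n - c)² ≥ n²/2 - c²`.
  have h := (summable_and_tsum_exp_neg_mul_int_sq_le (half_pos hb)).1.mul_left
    (Real.exp (b * c ^ 2))
  refine Summable.of_nonneg_of_le (fun n => (Real.exp_pos _).le) (fun n => ?_) h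
  rw [← Real.exp_add]
  refine Real.exp_le_exp.2 ?_
  nlinarith [mul_nonneg hb.le (sq_nonneg ((n : ℝ) - 2 * c))]

/-- A shifted Gaussian sum is at most the centred one, by Poisson summation. -/
theorem tsum_exp_neg_int_sub_sq_le {a : ℝ} (ha : 0 < a) (c : ℝ) :
    ∑' n : ℤ, Real.exp (-(Real.pi / a * ((n : ℝ) - c) ^ 2)) ≤
      √a * ∑' n : ℤ, Real.exp (-(Real.pi * a * (n : ℝ) ^ 2)) := by
  -- With parameter `I * c` the shift is real on one side and a unimodular phase on the dual side;
  -- the triangle inequality discards the phase.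
  have hP := Complex.tsum_exp_neg_quadratic (a := (a : ℂ)) (by simpa using ha) (Complex.I * c)
  have e1 : ∑' n : ℤ, Complex.exp (-Real.pi / a * (n + Complex.I * (Complex.I * c)) ^ 2) =
      ((∑' n : ℤ, Real.exp (-(Real.pi / a * ((n : ℝ) - c) ^ 2)) : ℝ) : ℂ) := by
    rw [Complex.ofReal_tsum]
    refine tsum_congr fun n => ?_
    rw [← mul_assoc, Complex.I_mul_I]
    push_cast
    congr 1
    ring
  have e2 : (a : ℂ) ^ (1 / 2 : ℂ) = ((√a : ℝ) : ℂ) := by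
    rw [Real.sqrt_eq_rpow, Complex.ofReal_cpow ha.le]
    norm_num
  have hs : 0 < √a := Real.sqrt_pos.2 ha
  rw [e1, e2] at hP
  have hT : 0 ≤ ∑' n : ℤ, Real.exp (-(Real.pi / a * ((n : ℝ) - c) ^ 2)) :=
    tsum_nonneg fun n => (Real.exp_pos _).le
  have hn := congrArg norm hP
  rw [norm_mul, norm_div, norm_one, Complex.norm_real, Complex.norm_real, Real.norm_of_nonneg hs.le,
    Real.norm_of_nonneg hT] at hn
  have e3 : ∀ n : ℤ, ‖Complex.exp (-Real.pi * a * n ^ 2 + 2 * Real.pi * (Complex.I * c) * n)‖ =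
      Real.exp (-(Real.pi * a * (n : ℝ) ^ 2)) := by
    intro n
    rw [Complex.norm_exp]
    congr 1
    have : (-Real.pi * a * n ^ 2 + 2 * Real.pi * (Complex.I * c) * n : ℂ) =
        ((-(Real.pi * a * (n : ℝ) ^ 2) : ℝ) : ℂ) + ((2 * Real.pi * c * n : ℝ) : ℂ) * Complex.I := by
      push_cast; ring
    rw [this, Complex.add_re, Complex.ofReal_re, Complex.re_ofReal_mul, Complex.I_re]
    ring
  have h4 := norm_tsum_le_tsum_norm (f := fun n : ℤ =>
    Complex.exp (-Real.pi * a * n ^ 2 + 2 * Real.pi * (Complex.I * c) * n)) (by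
      simp_rw [e3]
      exact (summable_and_tsum_exp_neg_mul_int_sq_le (by positivity)).1)
  simp_rw [e3] at h4
  rw [hn, one_div, inv_mul_le_iff₀ hs] at h4
  exact h4

/-- The crude tail bound by `∑ 1/n²` produces the constant `2/(3e)`; the comparison amounts to `32π
≤ 81e`. -/
theorem two_div_three_exp_le_eta : 2 / (3 * Real.exp 1) ≤ eta := by
  have he := Real.exp_one_gt_d9
  have hpi := Real.pi_lt_d2
  have hpi0 := Real.pi_pos
  refine Real.le_sqrt_of_sq_le ?_
  rw [div_pow, div_le_div_iff₀ (by positivity) (by positivity)]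
  nlinarith [mul_pos (Real.exp_pos 1) hpi0]

theorem eta_nonneg : 0 ≤ eta := Real.sqrt_nonneg _

/-- A Riemann sum with step `2 / √k` of a Gaussian function of precision `τ`. -/
theorem sum_gaussian_le {k : ℕ} (hk : 0 < k) {τ : ℝ} (hτ : 0 < τ) (c : ℝ) (s : Finset ℕ) :
    ∑ j ∈ s, √(2 / (Real.pi * k)) * Real.exp (-(2 * τ / k * ((j : ℝ) - c) ^ 2)) ≤
      1 / √τ * (1 + eta * τ / k) := by
  have hk' : (0 : ℝ) < k := by exact_mod_cast hk
  -- The dual precision `πa` is of order `k/τ`, so the nonzero frequencies contribute only `O(τ/k)`.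
  set a : ℝ := Real.pi * k / (2 * τ) with ha
  have ha0 : 0 < a := by positivity
  have hpa : Real.pi / a = 2 * τ / k := by rw [ha]; field_simp
  rw [← Finset.mul_sum]
  have h1 : ∑ j ∈ s, Real.exp (-(2 * τ / k * ((j : ℝ) - c) ^ 2)) ≤
      ∑' n : ℤ, Real.exp (-(Real.pi / a * ((n : ℝ) - c) ^ 2)) := by
    have hsum := summable_exp_neg_mul_int_sub_sq (div_pos Real.pi_pos ha0) c
    have := hsum.sum_le_tsum (s.map ⟨((↑) : ℕ → ℤ), Nat.cast_injective⟩)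
      (fun n _ => (Real.exp_pos _).le)
    rw [Finset.sum_map] at this
    rw [hpa] at this ⊢
    simpa using this
  have h2 := tsum_exp_neg_int_sub_sq_le ha0 c
  have h3 := (summable_and_tsum_exp_neg_mul_int_sq_le (mul_pos Real.pi_pos ha0)).2
  have h4 : 1 + Real.pi ^ 2 / (3 * (Real.exp 1 * (Real.pi * a))) ≤ 1 + eta * τ / k := by
    have e : Real.pi ^ 2 / (3 * (Real.exp 1 * (Real.pi * a))) = 2 / (3 * Real.exp 1) * (τ / k) := by
      rw [ha]; field_simp
    rw [e, mul_div_assoc]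
    gcongr
    exact two_div_three_exp_le_eta
  have h5 : √(2 / (Real.pi * k)) * √a = 1 / √τ := by
    rw [← Real.sqrt_mul (by positivity), ha, one_div, ← Real.sqrt_inv]
    congr 1
    field_simp
  calc _ ≤ √(2 / (Real.pi * k)) * (√a * (1 + eta * τ / k)) := by
        refine mul_le_mul_of_nonneg_left ((h1.trans h2).trans ?_) (Real.sqrt_nonneg _)
        exact mul_le_mul_of_nonneg_left (h3.trans h4) (Real.sqrt_nonneg _)
    _ = _ := by rw [← mul_assoc, h5]

/-! ### Sums of random signs -/

instance isProbabilityMeasure_signLaw (a : ℝ) : IsProbabilityMeasure (signLaw a) :=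
  ⟨by simp [signLaw, ENNReal.inv_two_add_inv_two]⟩

theorem lintegral_signLaw (a : ℝ) (h : ℝ → ENNReal) :
    ∫⁻ x, h x ∂signLaw a = 2⁻¹ * h a + 2⁻¹ * h (-a) := by
  simp [signLaw, lintegral_add_measure, lintegral_smul_measure]

theorem lintegral_of_indepFun {Ω α β : Type*} [MeasurableSpace Ω] [MeasurableSpace α]
    [MeasurableSpace β] {μ : Measure Ω} [IsProbabilityMeasure μ] {X : Ω → α} {Y : Ω → β}
    (hXY : IndepFun X Y μ) (hX : Measurable X) (hY : Measurable Y) {f : α → β → ENNReal}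
    (hf : Measurable (Function.uncurry f)) :
    ∫⁻ ω, f (X ω) (Y ω) ∂μ = ∫⁻ ω, ∫⁻ ω', f (X ω) (Y ω') ∂μ ∂μ := by
  have h1 := (indepFun_iff_map_prod_eq_prod_map_map hX.aemeasurable hY.aemeasurable).1 hXY
  have h2 : ∫⁻ ω, f (X ω) (Y ω) ∂μ =
      ∫⁻ p, Function.uncurry f p ∂(μ.map fun ω => (X ω, Y ω)) := by
    rw [lintegral_map hf (hX.prodMk hY)]; rfl
  have := Measure.isProbabilityMeasure_map (μ := μ) hX.aemeasurable
  have := Measure.isProbabilityMeasure_map (μ := μ) hY.aemeasurable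
  rw [h2, h1, lintegral_prod _ hf.aemeasurable, lintegral_map (by fun_prop) hX]
  refine lintegral_congr fun ω => ?_
  rw [lintegral_map (by fun_prop) hY]
  rfl

theorem iIndepFun_eval_signLaw (ι : Type*) [Fintype ι] (a : ℝ) :
    iIndepFun (fun (i : ι) (z : ι → ℝ) => z i) (Measure.pi fun _ => signLaw a) :=
  iIndepFun_pi (X := fun _ x => x) fun _ => aemeasurable_id

/-- Conditioning on one sign gives Pascal's rule; `h` varies in the induction because that sign
shifts its argument. -/
theorem lintegral_sum_signs_antidiagonal {ι : Type*} [Fintype ι] (a : ℝ) (I : Finset ι)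
    (h : ℝ → ENNReal) (hh : Measurable h) :
    ∫⁻ z, h (∑ i ∈ I, z i) ∂(Measure.pi fun _ : ι => signLaw a) =
      ∑ p ∈ Finset.HasAntidiagonal.antidiagonal I.card,
        (I.card.choose p.1 : ENNReal) * (2⁻¹ ^ I.card * h (a * (p.1 - p.2))) := by
  classical
  induction I using Finset.induction_on generalizing h with
  | empty => simp
  | insert i I hi ih =>
    have hind := ((iIndepFun_eval_signLaw ι a).indepFun_finsetSum_of_notMem
      (fun i => measurable_pi_apply i) hi).symm
    have hms : Measurable (∑ j ∈ I, fun z : ι → ℝ => z j) := by fun_prop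
    have step := lintegral_of_indepFun hind (measurable_pi_apply i) hms
      (f := fun x y => h (x + y)) (by fun_prop)
    simp only [Finset.sum_apply] at step
    simp_rw [Finset.sum_insert hi]
    rw [step, (measurePreserving_eval (fun _ : ι => signLaw a) i).lintegral_comp
      (f := fun x => ∫⁻ z, h (x + ∑ j ∈ I, z j) ∂(Measure.pi fun _ : ι => signLaw a))
      (by fun_prop), lintegral_signLaw, ih (fun y => h (a + y)) (by fun_prop),
      ih (fun y => h (-a + y)) (by fun_prop), Finset.card_insert_of_notMem hi,
      Finset.sum_antidiagonal_choose_succ_mul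
        (fun p q => 2⁻¹ ^ (I.card + 1) * h (a * ((p : ℝ) - q)))]
    rw [add_comm, Finset.mul_sum, Finset.mul_sum]
    congr 1
    · refine Finset.sum_congr rfl fun p _ => ?_
      have : -a + a * ((p.1 : ℝ) - p.2) = a * (p.1 - ((p.2 + 1 : ℕ) : ℝ)) := by push_cast; ring
      rw [this, pow_succ]
      ring
    · refine Finset.sum_congr rfl fun p hp => ?_
      have : a + a * ((p.1 : ℝ) - p.2) = a * (((p.1 + 1 : ℕ) : ℝ) - p.2) := by push_cast; ring
      rw [this, pow_succ, Nat.choose_symm_of_eq_add (Finset.HasAntidiagonal.mem_antidiagonal.1 hp).symm]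
      ring

/-- A sum of `k` independent signs is binomial. -/
theorem lintegral_sum_signs {ι : Type*} [Fintype ι] (a : ℝ) (I : Finset ι)
    (h : ℝ → ENNReal) (hh : Measurable h) :
    ∫⁻ z, h (∑ i ∈ I, z i) ∂(Measure.pi fun _ : ι => signLaw a) =
      ∑ j ∈ Finset.range (I.card + 1),
        ENNReal.ofReal (I.card.choose j * (1 / 2) ^ I.card) * h (a * (2 * j - I.card)) := by
  rw [lintegral_sum_signs_antidiagonal a I h hh,
    Finset.Nat.sum_antidiagonal_eq_sum_range_succ_mk]
  refine Finset.sum_congr rfl fun j hj => ?_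
  have hj' : j ≤ I.card := by simpa [Nat.lt_succ_iff] using hj
  have e : (j : ℝ) - ((I.card - j : ℕ) : ℝ) = 2 * j - I.card := by
    rw [Nat.cast_sub hj']; ring
  have e2 : ENNReal.ofReal (I.card.choose j * (1 / 2) ^ I.card) =
      (I.card.choose j : ENNReal) * 2⁻¹ ^ I.card := by
    rw [ENNReal.ofReal_mul (by positivity), ENNReal.ofReal_natCast,
      ENNReal.ofReal_pow (by norm_num), one_div, ENNReal.ofReal_inv_of_pos two_pos]
    simp
  simp only
  rw [e, e2, mul_assoc]

/-- Comparison of a sum of signs with the Gaussian law of the same variance `V`, for the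
exponential of a quadratic function. -/
theorem lintegral_exp_sum_signs_le {ι : Type*} [Fintype ι] {a V : ℝ} {I : Finset ι}
    (hI : 0 < I.card) (hV : 0 < V) (haV : a ^ 2 * I.card = V) {Q : ℝ → ℝ} {τ m : ℝ} (hτ : 0 < τ)
    (hQm : Measurable Q) (hQ : ∀ u, u ^ 2 / (2 * V) + Q u = τ * (u - m) ^ 2 / (2 * V)) :
    ∫⁻ z, ENNReal.ofReal (Real.exp (-Q (∑ i ∈ I, z i))) ∂(Measure.pi fun _ : ι => signLaw a) ≤
      ENNReal.ofReal (Real.exp (phi I.card) * (1 / √τ * (1 + eta * τ / I.card))) := by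
  rw [lintegral_sum_signs a I (fun u => ENNReal.ofReal (Real.exp (-Q u))) (by fun_prop)]
  set k := I.card with hk
  have hk' : (0 : ℝ) < k := by exact_mod_cast hI
  have ha : a ≠ 0 := by rintro rfl; simp at haV; exact hV.ne haV
  simp_rw [← ENNReal.ofReal_mul (show 0 ≤ (k.choose _ : ℝ) * (1 / 2) ^ k by positivity)]
  rw [← ENNReal.ofReal_sum_of_nonneg (fun j _ => by positivity)]
  refine ENNReal.ofReal_le_ofReal ?_
  -- The centre `k/2 + m/(2a)` is the solution `j` of `a(2j - k) = m`.
  refine le_trans ?_ (mul_le_mul_of_nonneg_left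
    (sum_gaussian_le hI hτ (k / 2 + m / (2 * a)) (Finset.range (k + 1))) (Real.exp_pos _).le)
  rw [Finset.mul_sum]
  refine Finset.sum_le_sum fun j hj => ?_
  have hj' : j ≤ k := by simpa [Nat.lt_succ_iff] using hj
  refine (mul_le_mul_of_nonneg_right (choose_div_two_pow_le hI hj') (Real.exp_pos _).le).trans
    (le_of_eq ?_)
  rw [mul_assoc, mul_assoc, ← Real.exp_add]
  congr 3
  have h1 := hQ (a * (2 * j - k))
  have e1 : (a * (2 * (j : ℝ) - k)) ^ 2 / (2 * V) = (2 * j - k) ^ 2 / (2 * k) := by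
    rw [← haV]; field_simp
  have e2 : τ * (a * (2 * (j : ℝ) - k) - m) ^ 2 / (2 * V) =
      2 * τ / k * ((j : ℝ) - (k / 2 + m / (2 * a))) ^ 2 := by
    rw [← haV]; field_simp; ring
  rw [e1, e2] at h1
  linarith

/-! ### The moments attached to one row -/

/-- Ratio of the `N(w, s)` density at `y` to the `N(0, s + V)` density, up to normalisation. -/
def rowWeight (s V y w : ℝ) : ENNReal :=
  ENNReal.ofReal (Real.exp (1 / 2 * (y ^ 2 / (s + V) - (y - w) ^ 2 / s)))

/-- Tilting function of the noise `e` and of the contribution `u` of the replaced columns. -/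
def rowTilt (s V t u e : ℝ) : ENNReal :=
  ENNReal.ofReal (Real.exp (t / 2 * (e ^ 2 / s - (u + e) ^ 2 / (s + V))))

theorem measurable_rowTilt (s V t : ℝ) :
    Measurable fun p : ℝ × ℝ => rowTilt s V t p.1 p.2 := by
  unfold rowTilt; fun_prop

/-- Mixing `N(w, s)` over `w ~ N(0, V)` gives `N(0, s + V)`, so the square completes with no
remainder and the bound does not depend on `y`. -/
theorem lintegral_rowWeight_le {ι : Type*} [Fintype ι] {a V s : ℝ} {I : Finset ι}
    (hI : 0 < I.card) (hV : 0 < V) (haV : a ^ 2 * I.card = V) (hs : 0 < s) (y : ℝ) :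
    ∫⁻ z, rowWeight s V y (∑ i ∈ I, z i) ∂(Measure.pi fun _ : ι => signLaw a) ≤
      ENNReal.ofReal (Real.exp (phi I.card) *
        (1 / √(1 + V / s) * (1 + eta * (1 + V / s) / I.card))) := by
  have := lintegral_exp_sum_signs_le hI hV haV (τ := 1 + V / s) (m := y * V / (s + V))
    (Q := fun w => -(1 / 2 * (y ^ 2 / (s + V) - (y - w) ^ 2 / s))) (by positivity)
    (by fun_prop) (fun u => by field_simp; ring)
  simpa only [rowWeight, neg_neg] using this

theorem lintegral_gaussian_rowTilt {s V t : ℝ} (hs : 0 < s) (hV : 0 < V)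
    (ht1 : t ≤ 1) (u : ℝ) :
    ∫⁻ e, rowTilt s V t u e ∂(gaussianReal 0 s.toNNReal) =
      ENNReal.ofReal (1 / √(1 - t * (V / (s + V)))) *
        ENNReal.ofReal (Real.exp (-(t * (1 - t) * u ^ 2 / (2 * (s + V - t * V))))) := by
  have hD : 0 < s + V - t * V := by nlinarith
  have hs' : s.toNNReal ≠ 0 := by simpa using hs
  -- The variance after tilting: `1/s1 = (1 - t)/s + t/(s + V)`.
  set s1 : ℝ := s * (s + V) / (s + V - t * V) with hs1
  have hs1p : 0 < s1 := by positivity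
  have hs1' : s1.toNNReal ≠ 0 := by simpa using hs1p
  have h1t : 1 - t * (V / (s + V)) = s / s1 := by rw [hs1]; field_simp
  rw [gaussianReal_of_var_ne_zero _ hs', lintegral_withDensity_eq_lintegral_mul _
    (measurable_gaussianPDF _ _) (by unfold rowTilt; fun_prop)]
  have key : ∀ e, (gaussianPDF 0 s.toNNReal * rowTilt s V t u) e =
      ENNReal.ofReal (1 / √(1 - t * (V / (s + V)))) *
        ENNReal.ofReal (Real.exp (-(t * (1 - t) * u ^ 2 / (2 * (s + V - t * V))))) *
        gaussianPDF (-(t * s * u / (s + V - t * V))) s1.toNNReal e := by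
    intro e
    simp only [Pi.mul_apply, gaussianPDF, rowTilt, gaussianPDFReal, Real.coe_toNNReal _ hs.le,
      Real.coe_toNNReal _ hs1p.le]
    rw [← ENNReal.ofReal_mul (by positivity), ← ENNReal.ofReal_mul (by positivity),
      ← ENNReal.ofReal_mul (by positivity), mul_assoc, ← Real.exp_add]
    congr 1
    have e1 : 1 / √(1 - t * (V / (s + V))) * (√(2 * Real.pi * s1))⁻¹ = (√(2 * Real.pi * s))⁻¹ := by
      rw [h1t, one_div, ← mul_inv, ← Real.sqrt_mul (by positivity)]
      congr 2
      field_simp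
    rw [← e1]
    have e2 : -(e - 0) ^ 2 / (2 * s) + t / 2 * (e ^ 2 / s - (u + e) ^ 2 / (s + V)) =
        -(t * (1 - t) * u ^ 2 / (2 * (s + V - t * V))) +
          -(e - -(t * s * u / (s + V - t * V))) ^ 2 / (2 * s1) := by
      rw [hs1]; field_simp; ring
    rw [e2, Real.exp_add]
    ring
  simp_rw [key]
  rw [lintegral_const_mul _ (measurable_gaussianPDF _ _), lintegral_gaussianPDF_eq_one _ hs1',
    mul_one]

theorem lintegral_rowTilt_le {ι : Type*} [Fintype ι] {a V s t : ℝ} {I : Finset ι}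
    (hI : 0 < I.card) (hV : 0 < V) (haV : a ^ 2 * I.card = V) (hs : 0 < s) (ht0 : 0 ≤ t)
    (ht1 : t ≤ 1) :
    ∫⁻ z, ∫⁻ e, rowTilt s V t (∑ i ∈ I, z i) e ∂(gaussianReal 0 s.toNNReal)
        ∂(Measure.pi fun _ : ι => signLaw a) ≤
      ENNReal.ofReal (Real.exp (phi I.card) *
        (1 / √(1 - t ^ 2 * (V / (s + V))) * (1 + 2 * eta / I.card))) := by
  have hk' : (0 : ℝ) < I.card := by exact_mod_cast hI
  simp_rw [lintegral_gaussian_rowTilt hs hV ht1]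
  rw [lintegral_const_mul _ (by fun_prop)]
  set q : ℝ := V / (s + V) with hq
  have hq0 : 0 < q := by positivity
  have hq1 : q < 1 := by rw [hq, div_lt_one (by positivity)]; linarith
  have hD : 0 < s + V - t * V := by nlinarith
  have h1 : 0 < 1 - t * q := by nlinarith
  have h2 : 0 < 1 - t ^ 2 * q := by
    have : t ^ 2 ≤ 1 := pow_le_one₀ ht0 ht1
    nlinarith
  have hκ : 0 < (1 - t ^ 2 * q) / (1 - t * q) := by positivity
  have h := lintegral_exp_sum_signs_le hI hV haV (τ := (1 - t ^ 2 * q) / (1 - t * q)) (m := 0)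
    (Q := fun u => t * (1 - t) * u ^ 2 / (2 * (s + V - t * V))) hκ (by fun_prop) (fun u => by
      have : (1 - t ^ 2 * q) / (1 - t * q) = (s + V - t ^ 2 * V) / (s + V - t * V) := by
        rw [div_eq_div_iff h1.ne' hD.ne', hq]
        field_simp
      rw [this, div_add_div _ _ (by positivity) (by positivity), div_mul_eq_mul_div, div_div,
        div_eq_div_iff (by positivity) (by positivity)]
      ring)
  refine (mul_le_mul_right h _).trans ?_
  rw [← ENNReal.ofReal_mul (by positivity)]
  refine ENNReal.ofReal_le_ofReal ?_
  -- Equivalent to `q t(2 - t) ≤ 1`; this is the source of the factor `1 + 2η/k`.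
  have hκ2 : (1 - t ^ 2 * q) / (1 - t * q) ≤ 2 := by
    rw [div_le_iff₀ h1]
    nlinarith [mul_nonneg ht0 (sub_nonneg.2 ht1), sq_nonneg (1 - t)]
  have e : 1 / √(1 - t * q) * (1 / √((1 - t ^ 2 * q) / (1 - t * q))) = 1 / √(1 - t ^ 2 * q) := by
    rw [one_div_mul_one_div, ← Real.sqrt_mul h1.le]
    congr 2
    field_simp
  calc _ = Real.exp (phi I.card) * ((1 / √(1 - t * q) * (1 / √((1 - t ^ 2 * q) / (1 - t * q)))) *
        (1 + eta * ((1 - t ^ 2 * q) / (1 - t * q)) / I.card)) := by ring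
    _ ≤ _ := by
      rw [e]
      have := mul_le_mul_of_nonneg_left hκ2 eta_nonneg
      rw [mul_comm _ (2 : ℝ)] at this
      refine mul_le_mul_of_nonneg_left (mul_le_mul_of_nonneg_left ?_ (by positivity))
        (Real.exp_pos _).le
      exact add_le_add_right (div_le_div_of_nonneg_right this hk'.le) 1

theorem indepFun_sum_signs {ι : Type*} [Fintype ι] (a : ℝ) {I J : Finset ι}
    (hIJ : Disjoint I J) :
    IndepFun (fun z : ι → ℝ => ∑ i ∈ I, z i) (fun z : ι → ℝ => ∑ i ∈ J, z i)
      (Measure.pi fun _ : ι => signLaw a) := by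
  have h := (iIndepFun_eval_signLaw ι a).indepFun_finset I J hIJ fun i => measurable_pi_apply i
  have h' := h.comp (φ := fun x : I → ℝ => ∑ i, x i) (ψ := fun x : J → ℝ => ∑ i, x i)
    (by fun_prop) (by fun_prop)
  have e : ∀ K : Finset ι, (fun z : ι → ℝ => ∑ i ∈ K, z i) =
      (fun x : K → ℝ => ∑ i, x i) ∘ fun z (i : K) => z i := fun K => by
    ext z
    exact (Finset.sum_coe_sort K z).symm
  rw [e I, e J]
  exact h'

/-- A factor depending on an independent variable is integrated out first. -/
theorem lintegral_mul_le_of_indepFun {Ω α : Type*} [MeasurableSpace Ω] [MeasurableSpace α]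
    {μ : Measure Ω} [IsProbabilityMeasure μ] {ν : Measure α} [SFinite ν] {X Y : Ω → ℝ}
    (hXY : IndepFun X Y μ) (hX : Measurable X) (hY : Measurable Y) {g : ℝ → α → ENNReal}
    {f : ℝ → α → ℝ → ENNReal} (hg : Measurable fun p : ℝ × α => g p.1 p.2)
    (hf : Measurable fun p : (ℝ × α) × ℝ => f p.1.1 p.1.2 p.2) {A : ENNReal}
    (hA : ∀ u e, ∫⁻ ω, f u e (Y ω) ∂μ ≤ A) :
    ∫⁻ ω, ∫⁻ e, g (X ω) e * f (X ω) e (Y ω) ∂ν ∂μ ≤ A * ∫⁻ ω, ∫⁻ e, g (X ω) e ∂ν ∂μ := by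
  have hprod : Measurable fun p : (ℝ × ℝ) × α => g p.1.1 p.2 * f p.1.1 p.2 p.1.2 :=
    (hg.comp (by fun_prop : Measurable fun p : (ℝ × ℝ) × α => (p.1.1, p.2))).mul
      (hf.comp (by fun_prop : Measurable fun p : (ℝ × ℝ) × α => ((p.1.1, p.2), p.1.2)))
  have hψ : Measurable (Function.uncurry fun u w : ℝ => ∫⁻ e, g u e * f u e w ∂ν) :=
    hprod.lintegral_prod_right'
  have hgX : Measurable fun ω => ∫⁻ e, g (X ω) e ∂ν :=
    (Measurable.lintegral_prod_right' hg).comp hX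
  rw [lintegral_of_indepFun hXY hX hY hψ, ← lintegral_const_mul _ hgX]
  refine lintegral_mono fun ω => ?_
  have hm : AEMeasurable (Function.uncurry fun (ω' : Ω) (e : α) =>
      g (X ω) e * f (X ω) e (Y ω')) (μ.prod ν) :=
    (hprod.comp (by fun_prop : Measurable fun p : Ω × α => ((X ω, Y p.1), p.2))).aemeasurable
  have hge : Measurable fun e => g (X ω) e :=
    hg.comp (by fun_prop : Measurable fun e : α => (X ω, e))
  calc ∫⁻ ω', ∫⁻ e, g (X ω) e * f (X ω) e (Y ω') ∂ν ∂μ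
      = ∫⁻ e, ∫⁻ ω', g (X ω) e * f (X ω) e (Y ω') ∂μ ∂ν := lintegral_lintegral_swap hm
    _ ≤ ∫⁻ e, A * g (X ω) e ∂ν := by
        refine lintegral_mono fun e => ?_
        have hfe : Measurable fun ω' => f (X ω) e (Y ω') :=
          hf.comp (by fun_prop : Measurable fun ω' : Ω => ((X ω, e), Y ω'))
        calc ∫⁻ ω', g (X ω) e * f (X ω) e (Y ω') ∂μ
            = g (X ω) e * ∫⁻ ω', f (X ω) e (Y ω') ∂μ := lintegral_const_mul _ hfe
          _ ≤ g (X ω) e * A := mul_le_mul_right (hA _ _) _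
          _ = A * g (X ω) e := mul_comm _ _
    _ = A * ∫⁻ e, g (X ω) e ∂ν := lintegral_const_mul _ hge

theorem lintegral_rowTilt_mul_rowWeight_le {ι : Type*} [Fintype ι] {a V s t : ℝ} {I J : Finset ι}
    (hIJ : Disjoint I J) (hJ : 0 < J.card) (hV : 0 < V) (haV : a ^ 2 * J.card = V) (hs : 0 < s) :
    ∫⁻ z : ι → ℝ, ∫⁻ e : ℝ, rowTilt s V t (∑ i ∈ I, z i) e *
          rowWeight s V (∑ i ∈ I, z i + e) (∑ i ∈ J, z i) ∂(gaussianReal 0 s.toNNReal)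
        ∂(Measure.pi fun _ : ι => signLaw a) ≤
      ENNReal.ofReal (Real.exp (phi J.card) *
        (1 / √(1 + V / s) * (1 + eta * (1 + V / s) / J.card))) *
      ∫⁻ z : ι → ℝ, ∫⁻ e : ℝ, rowTilt s V t (∑ i ∈ I, z i) e ∂(gaussianReal 0 s.toNNReal)
        ∂(Measure.pi fun _ : ι => signLaw a) := by
  have hX : ∀ K : Finset ι, Measurable fun z : ι → ℝ => ∑ i ∈ K, z i := fun K => by fun_prop
  have hind := indepFun_sum_signs a hIJ
  have hf : Measurable fun p : (ℝ × ℝ) × ℝ => rowWeight s V (p.1.1 + p.1.2) p.2 := by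
    unfold rowWeight; fun_prop
  have hA := fun u e : ℝ => lintegral_rowWeight_le hJ hV haV hs (u + e)
  exact lintegral_mul_le_of_indepFun (g := rowTilt s V t)
    (f := fun u e w => rowWeight s V (u + e) w) hind (hX I) (hX J) (measurable_rowTilt s V t) hf hA

/-! ### The union bound over the wrong sections -/

theorem lintegral_pi_prod {ι Ω : Type*} [Fintype ι] [MeasurableSpace Ω] (μ : Measure Ω)
    [IsProbabilityMeasure μ] {f : ι → Ω → ENNReal} (hf : ∀ i, Measurable (f i)) :
    ∫⁻ x, ∏ i, f i (x i) ∂(Measure.pi fun _ : ι => μ) = ∏ i, ∫⁻ x, f i x ∂μ := by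
  have hind : iIndepFun (fun (i : ι) (x : ι → Ω) => f i (x i)) (Measure.pi fun _ : ι => μ) :=
    iIndepFun_pi fun i => (hf i).aemeasurable
  rw [lintegral_prod_eq_prod_lintegral_of_indepFun Finset.univ _ hind
    fun i => (hf i).comp (measurable_pi_apply i)]
  exact Finset.prod_congr rfl fun i _ =>
    (measurePreserving_eval (fun _ : ι => μ) i).lintegral_comp (hf i)

theorem lintegral_pi_prod_pi {ι Ω Ω' : Type*} [Fintype ι] [MeasurableSpace Ω]
    [MeasurableSpace Ω'] (μ : Measure Ω) [IsProbabilityMeasure μ] (ν : Measure Ω')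
    [IsProbabilityMeasure ν] {f : Ω → Ω' → ENNReal} (hf : Measurable (Function.uncurry f)) :
    ∫⁻ p, ∏ i, f (p.1 i) (p.2 i)
        ∂((Measure.pi fun _ : ι => μ).prod (Measure.pi fun _ : ι => ν)) =
      (∫⁻ x, ∫⁻ y, f x y ∂ν ∂μ) ^ Fintype.card ι := by
  have hm : Measurable fun p : (ι → Ω) × (ι → Ω') => ∏ i, f (p.1 i) (p.2 i) :=
    Finset.measurable_prod _ fun i _ => hf.comp
      (by fun_prop : Measurable fun p : (ι → Ω) × (ι → Ω') => (p.1 i, p.2 i))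
  rw [lintegral_prod _ hm.aemeasurable]
  have h1 : ∀ x : ι → Ω, ∫⁻ y, ∏ i, f (x i) (y i) ∂(Measure.pi fun _ : ι => ν) =
      ∏ i, ∫⁻ y, f (x i) y ∂ν := fun x =>
    lintegral_pi_prod ν fun i => hf.of_uncurry_left
  simp_rw [h1]
  rw [lintegral_pi_prod μ (f := fun _ x => ∫⁻ y, f x y ∂ν) fun i => hf.lintegral_prod_right']
  simp

/-- Gallager's bound: a union bound interpolated by Hölder's inequality. -/
theorem measure_le_of_tilt {Ω κ : Type*} [MeasurableSpace Ω] {μ : Measure Ω} (B : Finset κ)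
    {G : Ω → ENNReal} {F : κ → Ω → ENNReal} (hG : Measurable G) (hF : ∀ b, Measurable (F b))
    {t : ℝ} (ht0 : 0 ≤ t) (ht1 : t ≤ 1) {c : ENNReal}
    (hGF : ∀ b ∈ B, ∫⁻ ω, G ω * F b ω ∂μ ≤ c * ∫⁻ ω, G ω ∂μ) {A : Set Ω}
    (hA : ∀ ω ∈ A, ∃ b ∈ B, 1 ≤ (G ω * F b ω) ^ t * G ω ^ (1 - t)) :
    μ A ≤ (B.card * c) ^ t * ∫⁻ ω, G ω ∂μ := by
  have hs : Measurable fun ω => ∑ b ∈ B, G ω * F b ω :=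
    Finset.measurable_sum _ fun b _ => hG.mul (hF b)
  have hH : Measurable fun ω => (∑ b ∈ B, G ω * F b ω) ^ t * G ω ^ (1 - t) :=
    (hs.pow_const _).mul (hG.pow_const _)
  have h1 : μ A ≤ μ {ω | 1 ≤ (∑ b ∈ B, G ω * F b ω) ^ t * G ω ^ (1 - t)} := by
    refine measure_mono fun ω hω => ?_
    obtain ⟨b, hb, h⟩ := hA ω hω
    refine h.trans (mul_le_mul_left (ENNReal.rpow_le_rpow ?_ ht0) _)
    exact Finset.single_le_sum (f := fun b => G ω * F b ω) (fun _ _ => zero_le) hb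
  have h2 := mul_meas_ge_le_lintegral (μ := μ) hH 1
  rw [one_mul] at h2
  -- Hölder with weights `t` and `1 - t`; since each `∫ G F b` is at most `c ∫ G`, the powers of `∫
  -- G` recombine to the first power.
  have h3 := ENNReal.lintegral_mul_norm_pow_le (μ := μ) hs.aemeasurable hG.aemeasurable ht0
    (sub_nonneg.2 ht1) (by ring : t + (1 - t) = 1)
  have h4 : ∫⁻ ω, ∑ b ∈ B, G ω * F b ω ∂μ ≤ B.card * c * ∫⁻ ω, G ω ∂μ := by
    rw [lintegral_finsetSum (f := fun b ω => G ω * F b ω) _ fun b _ => hG.mul (hF b)]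
    refine (Finset.sum_le_sum hGF).trans (le_of_eq ?_)
    rw [Finset.sum_const, nsmul_eq_mul, mul_assoc]
  refine (h1.trans (h2.trans (h3.trans (mul_le_mul_left (ENNReal.rpow_le_rpow h4 ht0) _)))).trans
    (le_of_eq ?_)
  rw [ENNReal.mul_rpow_of_nonneg _ _ ht0, mul_assoc,
    ← ENNReal.rpow_add_of_nonneg _ _ ht0 (sub_nonneg.2 ht1)]
  simp

/-- The coefficient vector selecting the column `b s` in each section `s`. -/
def selection {L M : ℕ} (b : Fin L → Fin M) : Fin L × Fin M → ℝ :=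
  fun j => if j.2 = b j.1 then 1 else 0

theorem exists_selection_eq {L M : ℕ} {β : Fin L × Fin M → ℝ} (hβ : β ∈ coeffSet L M) :
    ∃ b, β = selection b := by
  choose b hb hb' using hβ.2
  refine ⟨b, funext fun ⟨s, m⟩ => ?_⟩
  by_cases h : m = b s
  · subst h
    simp only [selection, if_true]
    exact hb s
  · simp only [selection, if_neg h]
    exact (hβ.1 (s, m)).resolve_right fun h1 => h (hb' s m h1)

/-- The sections in which two selections differ. -/
def wrongSections {L M : ℕ} (b' b : Fin L → Fin M) : Finset (Fin L) :=
  Finset.univ.filter fun s => b' s ≠ b s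

theorem mistakes_selection {L M : ℕ} (b' b : Fin L → Fin M) :
    mistakes (selection b') (selection b) = (wrongSections b' b).card := by
  rw [mistakes, ← Set.ncard_coe_finset]
  congr 1
  ext s
  simp only [selection, Set.mem_ofPred_eq, wrongSections, Finset.coe_filter, Finset.mem_univ,
    true_and]
  constructor
  · rintro ⟨m, hm⟩ h
    rw [h] at hm
    exact hm rfl
  · intro h
    refine ⟨b s, ?_⟩
    simp [Ne.symm h]

theorem mulVec_selection {n L M : ℕ} (X : Matrix (Fin n) (Fin L × Fin M) ℝ) (b : Fin L → Fin M)
    (i : Fin n) : (X *ᵥ selection b) i = ∑ s, X i (s, b s) := by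
  simp [Matrix.mulVec, dotProduct, selection, Fintype.sum_prod_type]

/-- The sign columns used by the selection `b` in the sections of `S`. -/
def signColumns {L M : ℕ} (d : ℕ) (S : Finset (Fin L)) (b : Fin L → Fin M) :
    Finset ((Fin L × Fin M) × Fin d) :=
  S.map ⟨fun s => (s, b s), fun _ _ h => (Prod.ext_iff.1 h).1⟩ ×ˢ Finset.univ

theorem card_signColumns {L M : ℕ} (d : ℕ) (S : Finset (Fin L)) (b : Fin L → Fin M) :
    (signColumns d S b).card = d * S.card := by
  simp [signColumns, mul_comm]

theorem sum_signColumns {L M d : ℕ} (S : Finset (Fin L)) (b : Fin L → Fin M)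
    (z : (Fin L × Fin M) × Fin d → ℝ) :
    ∑ j ∈ signColumns d S b, z j = ∑ s ∈ S, ∑ k, z ((s, b s), k) := by
  rw [signColumns, Finset.sum_product, Finset.sum_map]
  rfl

/-- The selections that differ from `b` exactly in the sections of `S`. -/
def competitors {L M : ℕ} (S : Finset (Fin L)) (b : Fin L → Fin M) : Finset (Fin L → Fin M) :=
  Finset.univ.filter fun b' => wrongSections b' b = S

/-- Outside `S` a competitor agrees with `b`, so it is determined by its restriction to `S`. This
count becomes the rate term `αR`. -/
theorem card_competitors_le {L M : ℕ} (S : Finset (Fin L)) (b : Fin L → Fin M) :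
    (competitors S b).card ≤ M ^ S.card := by
  have h : (competitors S b).card ≤ (Finset.univ : Finset (S → Fin M)).card := by
    refine Finset.card_le_card_of_injOn (fun b' s => b' s) (fun _ _ => Finset.mem_univ _) ?_
    intro b₁ h₁ b₂ h₂ h
    simp only [competitors, Finset.coe_filter, Finset.mem_univ, true_and, Set.mem_ofPred_eq] at h₁ h₂
    funext s
    by_cases hs : s ∈ S
    · exact congrFun h ⟨s, hs⟩
    · have e₁ : b₁ s = b s := by
        by_contra hne
        exact hs (h₁ ▸ Finset.mem_filter.2 ⟨Finset.mem_univ _, hne⟩)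
      have e₂ : b₂ s = b s := by
        by_contra hne
        exact hs (h₂ ▸ Finset.mem_filter.2 ⟨Finset.mem_univ _, hne⟩)
      rw [e₁, e₂]
  simpa using h

theorem disjoint_signColumns {L M : ℕ} (d : ℕ) {S : Finset (Fin L)} {b' b : Fin L → Fin M}
    (h : b' ∈ competitors S b) : Disjoint (signColumns d S b) (signColumns d S b') := by
  rw [Finset.disjoint_left]
  rintro ⟨⟨s, m⟩, k⟩ h1 h2
  have hS : wrongSections b' b = S := (Finset.mem_filter.1 h).2
  simp only [signColumns, Finset.mem_product, Finset.mem_map, Finset.mem_univ, and_true] at h1 h2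
  obtain ⟨s₁, hs₁, e₁⟩ := h1
  obtain ⟨s₂, -, e₂⟩ := h2
  obtain ⟨e₁, e₁'⟩ : s₁ = s ∧ b s₁ = m := Prod.ext_iff.1 e₁
  obtain ⟨e₂, e₂'⟩ : s₂ = s ∧ b' s₂ = m := Prod.ext_iff.1 e₂
  subst e₁ e₂
  rw [← hS] at hs₁
  exact (Finset.mem_filter.1 hs₁).2 (e₂'.trans e₁'.symm)

/-- The event that a competitor with wrong sections `S` is at least as close to the output as the
transmitted selection. -/
def confusionEvent {L M : ℕ} (d n : ℕ) (S : Finset (Fin L)) (b : Fin L → Fin M) :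
    Set ((Fin n → (Fin L × Fin M) × Fin d → ℝ) × (Fin n → ℝ)) :=
  {ω | ∃ b' ∈ competitors S b,
    ∑ i, (∑ j ∈ signColumns d S b, ω.1 i j + ω.2 i - ∑ j ∈ signColumns d S b', ω.1 i j) ^ 2 ≤
      ∑ i, ω.2 i ^ 2}

/-- Correctly decoded sections cancel in the residual, and the non-strict inequality in
`confusionEvent` covers every way of breaking ties. -/
theorem mistakesEvent_subset {d n L M : ℕ}
    {dec : Matrix (Fin n) (Fin L × Fin M) ℝ → (Fin n → ℝ) → (Fin L × Fin M → ℝ)}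
    (hdec : IsMLDecoder dec) {b : Fin L → Fin M} (hb : selection b ∈ coeffSet L M) (l : ℕ) :
    mistakesEvent (d := d) dec (selection b) l ⊆
      ⋃ S ∈ Finset.powersetCard l (Finset.univ : Finset (Fin L)), confusionEvent d n S b := by
  intro ω hω
  set X := dictionary ω.1 with hX
  set Y := X *ᵥ selection b + ω.2 with hY
  obtain ⟨hmem, hmin⟩ := hdec X Y
  obtain ⟨b', hb'⟩ := exists_selection_eq hmem
  have hl : (wrongSections b' b).card = l := by
    rw [← mistakes_selection, ← hb']
    exact hω
  simp only [Set.mem_iUnion]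
  refine ⟨wrongSections b' b, by simp [hl], b', by simp [competitors], ?_⟩
  have h := hmin _ hb
  rw [hb', EuclideanSpace.norm_sq_eq, EuclideanSpace.norm_sq_eq] at h
  simp only [Real.norm_eq_abs, sq_abs, Pi.sub_apply, hY, Pi.add_apply, mulVec_selection] at h
  have e : ∀ i, ∑ j ∈ signColumns d (wrongSections b' b) b, ω.1 i j + ω.2 i -
      ∑ j ∈ signColumns d (wrongSections b' b) b', ω.1 i j =
      ∑ s, X i (s, b s) + ω.2 i - ∑ s, X i (s, b' s) := by
    intro i
    have e1 : ∑ s ∈ wrongSections b' b, (X i (s, b s) - X i (s, b' s)) =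
        ∑ s, (X i (s, b s) - X i (s, b' s)) := by
      refine Finset.sum_subset (Finset.subset_univ _) fun s _ hs => ?_
      have : b' s = b s := by
        by_contra hne
        exact hs (Finset.mem_filter.2 ⟨Finset.mem_univ _, hne⟩)
      rw [this, sub_self]
    rw [Finset.sum_sub_distrib, Finset.sum_sub_distrib] at e1
    rw [sum_signColumns, sum_signColumns]
    simp only [hX, dictionary, Matrix.of_apply] at e1 ⊢
    linarith
  simp_rw [e]
  simpa using h

theorem prod_ofReal_exp {ι : Type*} [Fintype ι] (f : ι → ℝ) :
    ∏ i, ENNReal.ofReal (Real.exp (f i)) = ENNReal.ofReal (Real.exp (∑ i, f i)) := by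
  rw [Real.exp_sum, ENNReal.ofReal_prod_of_nonneg fun i _ => (Real.exp_pos _).le]

/-- In `G F^t` the terms in `(u + e)²/(s + V)` cancel, leaving `exp (t/(2s) (‖e‖² - ‖u + e - w‖²))`.
-/
theorem one_le_tilt {n : ℕ} {s V t : ℝ} (hs : 0 < s) (ht0 : 0 ≤ t) {u e w : Fin n → ℝ}
    (h : ∑ i, (u i + e i - w i) ^ 2 ≤ ∑ i, e i ^ 2) :
    1 ≤ ((∏ i, rowTilt s V t (u i) (e i)) * ∏ i, rowWeight s V (u i + e i) (w i)) ^ t *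
      (∏ i, rowTilt s V t (u i) (e i)) ^ (1 - t) := by
  unfold rowTilt rowWeight
  rw [prod_ofReal_exp, prod_ofReal_exp, ← ENNReal.ofReal_mul (Real.exp_pos _).le, ← Real.exp_add,
    ENNReal.ofReal_rpow_of_pos (Real.exp_pos _), ENNReal.ofReal_rpow_of_pos (Real.exp_pos _),
    ← Real.exp_mul, ← Real.exp_mul, ← ENNReal.ofReal_mul (Real.exp_pos _).le, ← Real.exp_add,
    ENNReal.one_le_ofReal, Real.one_le_exp_iff]
  have e1 : ∑ i, t / 2 * (e i ^ 2 / s - (u i + e i) ^ 2 / (s + V)) +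
      t * ∑ i, 1 / 2 * ((u i + e i) ^ 2 / (s + V) - (u i + e i - w i) ^ 2 / s) =
      t / (2 * s) * (∑ i, e i ^ 2 - ∑ i, (u i + e i - w i) ^ 2) := by
    rw [Finset.mul_sum, ← Finset.sum_add_distrib, ← Finset.sum_sub_distrib, Finset.mul_sum]
    refine Finset.sum_congr rfl fun i _ => ?_
    field_simp
    ring
  have e2 : 0 ≤ t / (2 * s) * (∑ i, e i ^ 2 - ∑ i, (u i + e i - w i) ^ 2) :=
    mul_nonneg (by positivity) (by linarith)
  linarith

theorem measure_confusionEvent_le {P σ : ℝ} (hP : 0 < P) (hσ : 0 < σ) {d n L M : ℕ} (hd : 0 < d)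
    {S : Finset (Fin L)} (hS : 0 < S.card) (b : Fin L → Fin M) {t V : ℝ} (ht0 : 0 ≤ t)
    (ht1 : t ≤ 1) (hV : V = P * S.card / L) :
    jointLaw P σ d n L M (confusionEvent d n S b) ≤
      ((M ^ S.card : ℕ) * ENNReal.ofReal (Real.exp (phi (d * S.card)) *
        (1 / √(1 + V / σ ^ 2) * (1 + eta * (1 + V / σ ^ 2) / (d * S.card : ℕ)))) ^ n) ^ t *
      ENNReal.ofReal (Real.exp (phi (d * S.card)) *
        (1 / √(1 - t ^ 2 * (V / (σ ^ 2 + V))) * (1 + 2 * eta / (d * S.card : ℕ)))) ^ n := by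
  have hLn : 0 < L := by
    obtain ⟨s, -⟩ := Finset.card_pos.1 hS
    exact s.pos
  have hL : (0 : ℝ) < L := by exact_mod_cast hLn
  have hd' : (0 : ℝ) < d := by exact_mod_cast hd
  have hS' : (0 : ℝ) < S.card := by exact_mod_cast hS
  have hV0 : 0 < V := by rw [hV]; positivity
  have hs : 0 < σ ^ 2 := by positivity
  set a : ℝ := √(P / (d * L)) with ha
  have hcard : ∀ b' : Fin L → Fin M, (signColumns d S b').card = d * S.card :=
    card_signColumns d S
  have haV : a ^ 2 * (d * S.card : ℕ) = V := by
    rw [ha, Real.sq_sqrt (by positivity), hV]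
    push_cast
    field_simp
  have hk : 0 < d * S.card := Nat.mul_pos hd hS
  have hGm : Measurable (Function.uncurry fun (z : (Fin L × Fin M) × Fin d → ℝ) (e : ℝ) =>
      rowTilt (σ ^ 2) V t (∑ j ∈ signColumns d S b, z j) e) := by
    unfold rowTilt Function.uncurry; fun_prop
  have hGFm : ∀ b', Measurable (Function.uncurry
      fun (z : (Fin L × Fin M) × Fin d → ℝ) (e : ℝ) =>
      rowTilt (σ ^ 2) V t (∑ j ∈ signColumns d S b, z j) e *
      rowWeight (σ ^ 2) V (∑ j ∈ signColumns d S b, z j + e) (∑ j ∈ signColumns d S b', z j)) := by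
    intro b'
    unfold rowTilt rowWeight Function.uncurry; fun_prop
  have hG := lintegral_pi_prod_pi (ι := Fin n)
    (Measure.pi fun _ : (Fin L × Fin M) × Fin d => signLaw a) (gaussianReal 0 (σ ^ 2).toNNReal) hGm
  have hGF := fun b' => lintegral_pi_prod_pi (ι := Fin n)
    (Measure.pi fun _ : (Fin L × Fin M) × Fin d => signLaw a) (gaussianReal 0 (σ ^ 2).toNNReal)
    (hGFm b')
  rw [Fintype.card_fin] at hG
  simp only [Fintype.card_fin, Finset.prod_mul_distrib] at hGF
  have key := measure_le_of_tilt (μ := jointLaw P σ d n L M) (competitors S b)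
    (G := fun ω => ∏ i, rowTilt (σ ^ 2) V t (∑ j ∈ signColumns d S b, ω.1 i j) (ω.2 i))
    (F := fun b' ω => ∏ i, rowWeight (σ ^ 2) V (∑ j ∈ signColumns d S b, ω.1 i j + ω.2 i)
      (∑ j ∈ signColumns d S b', ω.1 i j))
    (by unfold rowTilt; fun_prop) (fun b' => by unfold rowWeight; fun_prop) ht0 ht1
    (c := ENNReal.ofReal (Real.exp (phi (d * S.card)) *
        (1 / √(1 + V / σ ^ 2) * (1 + eta * (1 + V / σ ^ 2) / (d * S.card : ℕ)))) ^ n)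
    (fun b' hb' => by
      refine (hGF b').trans_le ((pow_le_pow_left' (lintegral_rowTilt_mul_rowWeight_le
        (disjoint_signColumns d hb') (by rwa [hcard]) hV0 (by rwa [hcard]) hs) n).trans ?_)
      rw [mul_pow, hcard]
      exact mul_le_mul_right hG.ge _)
    (A := confusionEvent d n S b)
    (fun ω ⟨b', hb', h⟩ => ⟨b', hb', one_le_tilt hs ht0 h⟩)
  refine key.trans (mul_le_mul' (ENNReal.rpow_le_rpow (mul_le_mul_left ?_ _) ht0) ?_)
  · exact_mod_cast card_competitors_le S b
  · refine hG.trans_le (pow_le_pow_left' ?_ n)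
    have := lintegral_rowTilt_le (I := signColumns d S b) (a := a) (by rwa [hcard]) hV0
      (by rwa [hcard]) hs ht0 ht1
    rwa [hcard] at this

theorem iotaTerm_le_iota' {v α₀ : ℝ} {d L l : ℕ} (h0 : α₀ * L ≤ l) (h1 : l ≤ L) (hα₀ : α₀ ≤ 1) :
    iotaTerm v d l ≤ iota' v α₀ d L :=
  (iota'_isGreatest v α₀ hα₀ d L).2 ⟨l, ⟨h0, h1⟩, rfl⟩

theorem mul_rate {n L : ℕ} (hn : 0 < n) (hL : 0 < L) (M l : ℕ) :
    n * (l / L * rate n L M) = l * Real.log M := by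
  have hn' : (n : ℝ) ≠ 0 := by exact_mod_cast hn.ne'
  have hL' : (L : ℝ) ≠ 0 := by exact_mod_cast hL.ne'
  rw [rate]
  field_simp

/-- After logarithms the main terms give `D`. The correction from `F` enters with factor `t ≤ 1` and
that from `G` with factor 1, hence `2φ`. -/
theorem rpow_mul_pow_le_exp {n M l : ℕ} (hM : 0 < M) {t w v q k φ ρ D ι : ℝ}
    (ht1 : t ≤ 1) (hw : 0 < w) (hwv : w ≤ v) (hk : 0 < k) (hφ : 0 ≤ φ)
    (hq : 0 < 1 - t ^ 2 * q) (hρ : n * ρ = l * Real.log M)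
    (hD : t * (1 / 2 * Real.log (1 + w) - ρ) + 1 / 2 * Real.log (1 - t ^ 2 * q) = D)
    (hι : 2 * φ + Real.log ((1 + eta * (1 + v) / k) * (1 + 2 * eta / k)) ≤ ι) :
    ((M : ℝ) ^ l * (Real.exp φ * (1 / √(1 + w) * (1 + eta * (1 + w) / k))) ^ n) ^ t *
        (Real.exp φ * (1 / √(1 - t ^ 2 * q) * (1 + 2 * eta / k))) ^ n ≤
      Real.exp (-(n * (D - ι))) := by
  have hη := eta_nonneg
  have hM' : (0 : ℝ) < M := by exact_mod_cast hM
  have hv : 0 < v := hw.trans_le hwv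
  rw [Real.log_mul (by positivity) (by positivity)] at hι
  have hl : Real.log (1 + eta * (1 + w) / k) ≤ Real.log (1 + eta * (1 + v) / k) :=
    Real.log_le_log (by positivity) (by gcongr)
  have hl0 : 0 ≤ Real.log (1 + eta * (1 + w) / k) :=
    Real.log_nonneg (by linarith [show 0 ≤ eta * (1 + w) / k by positivity])
  have hlog : ∀ x y : ℝ, 0 < x → 0 < y → Real.log (Real.exp φ * (1 / √x * y)) =
      φ - 1 / 2 * Real.log x + Real.log y := by
    intro x y hx hy
    rw [Real.log_mul (by positivity) (by positivity), Real.log_exp,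
      Real.log_mul (by positivity) (by positivity), one_div, Real.log_inv, Real.log_sqrt hx.le]
    ring
  rw [← Real.log_le_iff_le_exp (by positivity), Real.log_mul (by positivity) (by positivity),
    Real.log_rpow (by positivity), Real.log_mul (by positivity) (by positivity), Real.log_pow,
    Real.log_pow, Real.log_pow, hlog _ _ (by positivity) (by positivity),
    hlog _ _ hq (by positivity), ← hρ, ← hD]
  have htl : t * (φ + Real.log (1 + eta * (1 + w) / k)) ≤
      φ + Real.log (1 + eta * (1 + w) / k) :=
    mul_le_of_le_one_left (add_nonneg hφ hl0) ht1
  have hfin : t * (φ + Real.log (1 + eta * (1 + w) / k)) + φ + Real.log (1 + 2 * eta / k) - ι ≤ 0 :=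
    by linarith
  have := mul_nonpos_of_nonneg_of_nonpos (Nat.cast_nonneg (α := ℝ) n) hfin
  linarith

theorem measure_confusionEvent_le_exp {P σ α₀ : ℝ} (hP : 0 < P) (hσ : 0 < σ) (hα₀' : α₀ ≤ 1)
    {d n L M : ℕ} (hd : 0 < d) (hn : 0 < n) (hM : 0 < M) {S : Finset (Fin L)} (hS : 0 < S.card)
    (hαS : α₀ * L ≤ S.card) (b : Fin L → Fin M) :
    jointLaw P σ d n L M (confusionEvent d n S b) ≤
      ENNReal.ofReal (Real.exp (-(n * (D₁ (capacity (P / σ ^ 2) (S.card / L) -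
        S.card / L * rate n L M) (S.card / L * (P / σ ^ 2) / (1 + S.card / L * (P / σ ^ 2))) -
        iota' (P / σ ^ 2) α₀ d L)))) := by
  have hLn : 0 < L := by
    obtain ⟨s, -⟩ := Finset.card_pos.1 hS
    exact s.pos
  have hSL : S.card ≤ L := by simpa using S.card_le_univ
  have hL : (0 : ℝ) < L := by exact_mod_cast hLn
  have hS' : (0 : ℝ) < S.card := by exact_mod_cast hS
  have hk : (0 : ℝ) < (d * S.card : ℕ) := by exact_mod_cast Nat.mul_pos hd hS
  set v : ℝ := P / σ ^ 2 with hv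
  have hv0 : 0 < v := by positivity
  set w : ℝ := S.card / L * v with hw
  have hw0 : 0 < w := by positivity
  have hwv : w ≤ v := by
    rw [hw]
    refine mul_le_of_le_one_left hv0.le ((div_le_one hL).2 ?_)
    exact_mod_cast hSL
  have hq1 : w / (1 + w) < 1 := by rw [div_lt_one (by positivity)]; linarith
  -- The Hölder parameter is the maximizer defining `D₁`.
  obtain ⟨t, ⟨ht0, ht1⟩, hD⟩ := (D₁_isGreatest (capacity v (S.card / L) -
        S.card / L * rate n L M) (w / (1 + w)) hq1).1
  have ht2 : 0 < 1 - t ^ 2 * (w / (1 + w)) := by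
    have : t ^ 2 ≤ 1 := pow_le_one₀ ht0 ht1
    have : 0 < w / (1 + w) := by positivity
    nlinarith
  set V : ℝ := P * S.card / L with hV
  have hVw : V / σ ^ 2 = w := by rw [hV, hw, hv]; field_simp
  have hVq : V / (σ ^ 2 + V) = w / (1 + w) := by
    rw [← hVw]; field_simp
  have h := measure_confusionEvent_le hP hσ (n := n) hd hS b ht0 ht1 hV
  rw [hVw, hVq] at h
  refine h.trans ?_
  have hη := eta_nonneg
  have hA : 0 ≤ Real.exp (phi (d * S.card)) *
      (1 / √(1 + w) * (1 + eta * (1 + w) / (d * S.card : ℕ))) := by positivity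
  have hB : 0 ≤ Real.exp (phi (d * S.card)) *
      (1 / √(1 - t ^ 2 * (w / (1 + w))) * (1 + 2 * eta / (d * S.card : ℕ))) := by positivity
  rw [← ENNReal.ofReal_natCast, ← ENNReal.ofReal_pow hA, ← ENNReal.ofReal_pow hB,
    ← ENNReal.ofReal_mul (Nat.cast_nonneg _),
    ENNReal.ofReal_rpow_of_nonneg (mul_nonneg (Nat.cast_nonneg _) (pow_nonneg hA _)) ht0,
    ← ENNReal.ofReal_mul (Real.rpow_nonneg (mul_nonneg (Nat.cast_nonneg _) (pow_nonneg hA _)) _),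
    Nat.cast_pow]
  exact ENNReal.ofReal_le_ofReal (rpow_mul_pow_le_exp hM ht1 hw0 hwv hk (phi_nonneg _) ht2
    (mul_rate hn hLn M S.card) hD (iotaTerm_le_iota' hαS hSL hα₀'))

theorem mistakesEvent_le {P σ α₀ : ℝ} (hP : 0 < P) (hσ : 0 < σ) (hα₀ : 0 < α₀) (hα₀' : α₀ ≤ 1)
    {d n L M : ℕ} (hd : 0 < d) (hn : 0 < n) (hL : 0 < L) (hM : 0 < M)
    {dec : Matrix (Fin n) (Fin L × Fin M) ℝ → (Fin n → ℝ) → (Fin L × Fin M → ℝ)}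
    (hdec : IsMLDecoder dec) {β : Fin L × Fin M → ℝ} (hβ : β ∈ coeffSet L M) {l : ℕ}
    (hα : α₀ ≤ (l : ℝ) / L) :
    (jointLaw P σ d n L M).real (mistakesEvent dec β l) ≤ errBin' (P / σ ^ 2) α₀ d n L M l := by
  obtain ⟨b, rfl⟩ := exists_selection_eq hβ
  have hL' : (0 : ℝ) < L := by exact_mod_cast hL
  have hl : α₀ * L ≤ l := (le_div_iff₀ hL').1 hα
  have hl0 : 0 < l := by
    have : (0 : ℝ) < l := (mul_pos hα₀ hL').trans_le hl
    exact_mod_cast this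
  refine ENNReal.toReal_le_of_le_ofReal (by unfold errBin'; positivity) ?_
  refine (measure_mono (mistakesEvent_subset hdec hβ l)).trans
    ((measure_biUnion_finset_le _ _).trans ?_)
  refine (Finset.sum_le_card_nsmul _ _ (ENNReal.ofReal (Real.exp (-(n * (D₁ (capacity (P / σ ^ 2)
    (l / L) - l / L * rate n L M) (l / L * (P / σ ^ 2) / (1 + l / L * (P / σ ^ 2))) -
    iota' (P / σ ^ 2) α₀ d L))))) fun S hS => ?_).trans (le_of_eq ?_)
  · obtain ⟨-, rfl⟩ := Finset.mem_powersetCard.1 hS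
    exact measure_confusionEvent_le_exp hP hσ hα₀' hd hn hM hl0 hl b
  · rw [Finset.card_powersetCard, Finset.card_univ, Fintype.card_fin, nsmul_eq_mul, errBin',
      ENNReal.ofReal_mul (by positivity), ENNReal.ofReal_natCast]

/-! ### Size of the correction term -/

theorem exists_neg_linear_add_log_le {a b c : ℝ} (ha : 0 < a) (hb : 0 ≤ b) :
    ∃ K : ℝ, ∀ x : ℝ, 0 < x → -a * x + b * Real.log x + c ≤ K / x := by
  -- The tangent bound `log x ≤ r x - log r` has slope small enough that `b r ≤ a/2`, with `b + 1`
  -- covering `b = 0`. What remains, `-(a/2)x² + Cx`, is at most `C²/(2a)`.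
  set r : ℝ := a / (2 * (b + 1)) with hr
  have hr0 : 0 < r := by positivity
  set C : ℝ := c + b * (-Real.log r) with hC
  refine ⟨C ^ 2 / (2 * a), fun x hx => ?_⟩
  have h1 : Real.log x ≤ r * x - Real.log r := by
    have := Real.log_le_sub_one_of_pos (mul_pos hr0 hx)
    rw [Real.log_mul hr0.ne' hx.ne'] at this
    linarith
  have h2 : b * r ≤ a / 2 := by
    rw [hr, mul_div_assoc', div_le_div_iff₀ (by positivity) two_pos]
    nlinarith
  have h3 : b * Real.log x ≤ a / 2 * x + b * (-Real.log r) := by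
    have := mul_le_mul_of_nonneg_left h1 hb
    have := mul_le_mul_of_nonneg_right h2 hx.le
    linarith
  rw [le_div_iff₀ hx]
  have h4 : (-a * x + b * Real.log x + c) * x ≤ (-(a / 2) * x + C) * x :=
    mul_le_mul_of_nonneg_right (by linarith) hx.le
  refine h4.trans ?_
  rw [le_div_iff₀ (by positivity)]
  nlinarith [sq_nonneg (a * x - C)]

/-- The fixed choice `ζ = 1/4` suffices: one branch is `O(1/k)`, and the others have negative linear
terms, using `log 2 > 1/2`, which beat the logarithms. -/
theorem exists_phi_le : ∃ K : ℝ, 0 ≤ K ∧ ∀ k : ℕ, 0 < k → phi k ≤ K / k := by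
  obtain ⟨K₁, h₁⟩ := exists_neg_linear_add_log_le (a := 4 * (1 / 4 : ℝ) ^ 4 / 3) (b := 1)
    (c := -Real.log 2) (by norm_num) zero_le_one
  obtain ⟨K₂, h₂⟩ := exists_neg_linear_add_log_le (a := Real.log 2 - 1 / 2) (b := 1 / 2)
    (c := 1 / 2 * Real.log (Real.pi / 2)) (by linarith [Real.log_two_gt_d9]) (by norm_num)
  set K₀ : ℝ := 3 / 16 * cZeta (1 / 4) ^ 2 + 1 / 12 with hK₀
  have hK₀0 : 0 ≤ K₀ := by positivity
  refine ⟨max (max K₀ (K₁ + 1 / 12)) K₂, hK₀0.trans ((le_max_left _ _).trans (le_max_left _ _)),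
    fun k hk => ?_⟩
  have hk' : (0 : ℝ) < k := by exact_mod_cast hk
  have hphi : phi k ≤ phiZeta (1 / 4) k :=
    csInf_le ⟨0, by rintro _ ⟨ζ, -, rfl⟩; exact phiZeta_nonneg ζ k⟩ ⟨1 / 4, by norm_num, rfl⟩
  refine hphi.trans (max_le (max_le ?_ ?_) ?_)
  · rw [mul_one_div]
    exact div_le_div_of_nonneg_right ((le_max_left _ _).trans (le_max_left _ _)) hk'.le
  · have := h₁ k hk'
    refine le_trans ?_ (div_le_div_of_nonneg_right ((le_max_right _ _).trans (le_max_left _ _))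
      hk'.le)
    rw [Real.log_div hk'.ne' two_ne_zero, add_div, show (1 : ℝ) / (12 * k) = 1 / 12 / k by
      field_simp]
    linarith
  · have := h₂ k hk'
    refine le_trans ?_ (div_le_div_of_nonneg_right (le_max_right _ _) hk'.le)
    rw [show Real.pi * k / 2 = Real.pi / 2 * k by ring,
      Real.log_mul (by positivity) hk'.ne']
    linarith

/-- At the maximizing `l` every summand is nonnegative and, by `log(1 + x) ≤ x`, of order `1/(dl)`,
while `dl ≥ α₀L` uniformly in `d`. -/
theorem exists_abs_iota'_le {v α₀ : ℝ} (hv : 0 < v) (hα₀ : 0 < α₀) (hα₀' : α₀ ≤ 1) :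
    ∃ K : ℝ, ∀ d L : ℕ, 0 < d → 0 < L → |iota' v α₀ d L| ≤ K / L := by
  obtain ⟨K, hK0, hK⟩ := exists_phi_le
  have hη := eta_nonneg
  set K' : ℝ := 2 * K + eta * (1 + v) + 2 * eta with hK'
  have hK'0 : 0 ≤ K' := by positivity
  refine ⟨K' / α₀, fun d L hd hL => ?_⟩
  have hL' : (0 : ℝ) < L := by exact_mod_cast hL
  obtain ⟨⟨l, ⟨hl, -⟩, hι⟩, -⟩ := iota'_isGreatest v α₀ hα₀' d L
  have hl' : (0 : ℝ) < l := (mul_pos hα₀ hL').trans_le hl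
  have hd1 : (1 : ℝ) ≤ d := by exact_mod_cast hd
  have hkn : 0 < d * l := Nat.mul_pos hd (by exact_mod_cast hl')
  have hk : (0 : ℝ) < (d * l : ℕ) := by exact_mod_cast hkn
  have hkl : α₀ * L ≤ ((d * l : ℕ) : ℝ) := by
    push_cast
    exact hl.trans (le_mul_of_one_le_left hl'.le hd1)
  rw [← hι]
  simp only [iotaTerm]
  set k : ℝ := ((d * l : ℕ) : ℝ) with hkdef
  have p1 : 0 ≤ eta * (1 + v) / k := by positivity
  have p2 : 0 ≤ 2 * eta / k := by positivity
  rw [Real.log_mul (by positivity) (by positivity)]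
  have l1 := Real.log_nonneg (show 1 ≤ 1 + eta * (1 + v) / k by linarith)
  have l2 := Real.log_nonneg (show 1 ≤ 1 + 2 * eta / k by linarith)
  have u1 := Real.log_le_sub_one_of_pos (show 0 < 1 + eta * (1 + v) / k by linarith)
  have u2 := Real.log_le_sub_one_of_pos (show 0 < 1 + 2 * eta / k by linarith)
  have hφ := hK (d * l) hkn
  rw [abs_of_nonneg (by linarith [phi_nonneg (d * l)])]
  calc _ ≤ K' / k := by
        have e : K' / k = 2 * (K / k) + eta * (1 + v) / k + 2 * eta / k := by rw [hK']; ring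
        rw [e]
        linarith
    _ ≤ K' / (α₀ * L) := div_le_div_of_nonneg_left hK'0 (by positivity) hkl
    _ = K' / α₀ / L := by rw [div_div]

end SSCode

end

theorem mainTheorem3 (P σ α₀ : ℝ) (hP : 0 < P) (hσ : 0 < σ) (hα₀ : 0 < α₀) (hα₀' : α₀ ≤ 1) :
    (∀ d n L M : ℕ, 0 < d → 0 < n → 0 < L → 0 < M →
      ∀ dec : Matrix (Fin n) (Fin L × Fin M) ℝ → (Fin n → ℝ) → (Fin L × Fin M → ℝ),
        SSCode.IsMLDecoder dec →
        ∀ β ∈ SSCode.coeffSet L M, ∀ l : ℕ, l ≤ L → α₀ ≤ (l : ℝ) / L →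
          (SSCode.jointLaw P σ d n L M).real (SSCode.mistakesEvent dec β l) ≤
            SSCode.errBin' (P / σ ^ 2) α₀ d n L M l) ∧
    (∃ K : ℝ, ∀ d L : ℕ, 0 < d → 0 < L → |SSCode.iota' (P / σ ^ 2) α₀ d L| ≤ K / L) :=
  ⟨fun _ _ _ _ hd hn hL hM _ hdec _ hβ _ _ hα =>
      SSCode.mistakesEvent_le hP hσ hα₀ hα₀' hd hn hL hM hdec hβ hα,
    SSCode.exists_abs_iota'_le (by positivity) hα₀ hα₀'⟩
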